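/- Let $A=\{a_1,\dots,a_n\}$ be a finite linearly ordered alphabet, let $A^+$ be the free semigroup of nonempty words over $A$, and let $\equiv$ denote equality of words. Let $k\ge 2$, let $x,y,a_{i_1},\dots,a_{i_k}\in A$, and let $$S=\mathrm{sgp}^+\langle A\mid a_{i_1}a_{i_2}\cdots a_{i_k}=xy\rangle$$ be the semigroup $A^+/\rho$, where $\rho$ is the congruence generated by the relation. Suppose that $a_{i_1}\cdots a_{i_k}>xy$ in the degree-lexicographic ordering and that $\{a_{i_1}a_{i_2}\cdots a_{i_k}=xy\}$ is a Gröbner–Shirshov basis with respect to this ordering (that is, every composition of the polynomial $a_{i_1}\cdots a_{i_k}-xy$ with itself in the free associative algebra $F\langle A\rangle$ over a field $F$ is trivial). If $a_{i_{k-1}}a_{i_k}\not\equiv xy$ and $a_{i_1}a_{i_2}\cdots a_{i_k}\not\equiv y^{k-1}x$, then $S$ is automatic, and the monoid $S^1$ obtained by adjoining a new identity element to $S$ is prefix-automatic. Here, for words $\alpha,\beta$ over a finite alphabet $B$, $(\alpha,\beta)\delta_B^R$ is the word over $(B\cup\{\$\})^2\setminus\{(\$,\$)\}$ obtained by reading $\alpha$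 and $\beta$ in parallel from the left, with the shorter one filled up on the right by a new symbol $\$$. A semigroup $T$ is automatic if there are a finite alphabet $B$, a homomorphism $\phi:B^+\to T$ and a regular language $L\subseteq B^+$ with $\phi(L)=T$ such that the languages $\{(\alpha,\beta)\delta_B^R\mid \alpha,\beta\in L,\ \phi(\alpha)=\phi(\beta)\}$ and, for every $b\in B$, $\{(\alpha,\beta)\delta_B^R\mid \alpha,\beta\in L,\ \phi(\alpha b)=\phi(\beta)\}$ are regular. It is prefix-automatic if $B,\phi,L$ can be chosen so that, in addition, $\{(\alpha,\beta)\delta_B^R\mid \alpha\in L,\ \beta \text{ a nonempty prefix of a word of } L,\ \phi(\alpha)=\phi(\beta)\}$ is regular. -/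

import Mathlib

universe u v

namespace AutoSgp

/-! ### Words and padded pairs of words -/

/-- The list of letters of a nonempty word; `FreeSemigroup A` plays the role of `A⁺`. -/
def letters {A : Type u} (w : FreeSemigroup A) : List A := w.head :: w.tail

/-- The alphabet `A(2,$) = (A ∪ {$}) × (A ∪ {$}) - {($,$)}`, where `none` is the padding
symbol `$`. -/
abbrev PadAlphabet (A : Type u) : Type u :=
  {p : Option A × Option A // p ≠ (none, none)}

/-- The right-padding map `δ_A^R : A* × A* → A(2,$)*`: the two words are read in parallel from the
left, and the shorter one is filled up with `$` on the right. -/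
def padRight {A : Type u} : List A → List A → List (PadAlphabet A)
  | [], [] => []
  | a :: s, [] => ⟨(some a, none), by simp⟩ :: padRight s []
  | [], b :: t => ⟨(none, some b), by simp⟩ :: padRight [] t
  | a :: s, b :: t => ⟨(some a, some b), by simp⟩ :: padRight s t

/-- The language over `B` formed by a set of nonempty words. -/
def wordLang {B : Type u} (L : Set (FreeSemigroup B)) : Language B :=
  letters '' L

/-- The language `{(α, β)δ^R | (α, β) ∈ U}` over `B(2,$)`. -/
def padLang {B : Type u} (U : Set (FreeSemigroup B × FreeSemigroup B)) :
    Language (PadAlphabet B) :=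
  (fun p => padRight (letters p.1) (letters p.2)) '' U

/-- The nonempty prefixes of words of `L`. -/
def pref {B : Type u} (L : Set (FreeSemigroup B)) : Set (FreeSemigroup B) :=
  {β | ∃ γ ∈ L, letters β <+: letters γ}

/-! ### Automatic and prefix-automatic semigroups -/

/-- `(B, L)` (with the homomorphism `φ : B⁺ → S`) is a (right-right) automatic structure
for `S`: `L ⊆ B⁺` is regular, `φ(L) = S`, and the languages `L_=^$` and `L_b^$` (`b ∈ B`) are
regular. -/
structure IsAutomaticStructure {S : Type u} [Semigroup S] {B : Type v}
    (φ : FreeSemigroup B →ₙ* S) (L : Set (FreeSemigroup B)) : Prop where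
  regular : (wordLang L).IsRegular
  image_eq : φ '' L = Set.univ
  regular_eq : (padLang {p | p.1 ∈ L ∧ p.2 ∈ L ∧ φ p.1 = φ p.2}).IsRegular
  regular_mul : ∀ b : B,
    (padLang {p | p.1 ∈ L ∧ p.2 ∈ L ∧ φ (p.1 * FreeSemigroup.of b) = φ p.2}).IsRegular

/-- `(B, L)` is a prefix-automatic structure for `S`: an automatic structure for which
`L'_= = {(α, β)δ^R | α ∈ L, β ∈ Pref(L), α = β in S}` is regular. -/
structure IsPrefixAutomaticStructure {S : Type u} [Semigroup S] {B : Type v}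
    (φ : FreeSemigroup B →ₙ* S) (L : Set (FreeSemigroup B)) : Prop
    extends IsAutomaticStructure φ L where
  regular_pref : (padLang {p | p.1 ∈ L ∧ p.2 ∈ pref L ∧ φ p.1 = φ p.2}).IsRegular

/-- `S` is an automatic semigroup. -/
def IsAutomatic (S : Type u) [Semigroup S] : Prop :=
  ∃ (B : Type u) (_ : Finite B) (φ : FreeSemigroup B →ₙ* S) (L : Set (FreeSemigroup B)),
    IsAutomaticStructure φ L

/-- `S` is a prefix-automatic semigroup. -/
def IsPrefixAutomatic (S : Type u) [Semigroup S] : Prop :=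
  ∃ (B : Type u) (_ : Finite B) (φ : FreeSemigroup B →ₙ* S) (L : Set (FreeSemigroup B)),
    IsPrefixAutomaticStructure φ L

/-! ### Semigroup presentations -/

/-- The semigroup `sgp⁺⟨A | R⟩ = A⁺ / ρ(R)`, where `ρ(R)` is the congruence on `A⁺` generated by
the set `R` of relations. -/
abbrev Sgp {A : Type u} (R : Set (FreeSemigroup A × FreeSemigroup A)) : Type u :=
  (conGen fun p q => (p, q) ∈ R).Quotient

/-! ### Gröbner–Shirshov bases in the free associative algebra -/

/-- The free associative algebra `F⟨A⟩`, with the words over `A` as a basis. -/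
abbrev FreeAlg (F : Type v) (A : Type u) [Field F] : Type (max v u) :=
  MonoidAlgebra F (FreeMonoid A)

/-- The word `w` as an element of `F⟨A⟩`. -/
noncomputable def mon (F : Type v) {A : Type u} [Field F] (w : FreeMonoid A) : FreeAlg F A :=
  MonoidAlgebra.of F (FreeMonoid A) w

/-- The deg-lex ordering on `A*`. -/
def degLex {A : Type u} [LinearOrder A] (s t : FreeMonoid A) : Prop :=
  List.Shortlex (fun a b : A => a < b) s.toList t.toList

/-- `w` is the leading word of `f`. -/
def IsLeadingWord {F : Type v} {A : Type u} [Field F] [LinearOrder A]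
    (f : FreeAlg F A) (w : FreeMonoid A) : Prop :=
  f.coeff w ≠ 0 ∧ ∀ w' : FreeMonoid A, f.coeff w' ≠ 0 → w' ≠ w → degLex w' w

/-- `f` is monic. -/
def IsMonic {F : Type v} {A : Type u} [Field F] [LinearOrder A] (f : FreeAlg F A) : Prop :=
  ∃ w, IsLeadingWord f w ∧ f.coeff w = 1

/-- `h` is trivial modulo `(R, w)`: it is a linear combination of elements `a s b` with `s ∈ R`,
`a, b ∈ A*` and `a s̄ b < w`. -/
def IsTrivialMod {F : Type v} {A : Type u} [Field F] [LinearOrder A]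
    (R : Set (FreeAlg F A)) (w : FreeMonoid A) (h : FreeAlg F A) : Prop :=
  h ∈ Submodule.span F {p : FreeAlg F A | ∃ s ∈ R, ∃ m a b : FreeMonoid A,
    IsLeadingWord s m ∧ degLex (a * m * b) w ∧ p = mon F a * s * mon F b}

/-- `R` is a Gröbner–Shirshov basis in `F⟨A⟩` with respect to the deg-lex ordering: all elements
are monic, and all intersection and inclusion compositions are trivial. -/
structure IsGroebnerShirshov {F : Type v} {A : Type u} [Field F] [LinearOrder A]
    (R : Set (FreeAlg F A)) : Prop where
  monic : ∀ f ∈ R, IsMonic f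
  intersection : ∀ f ∈ R, ∀ g ∈ R, ∀ mf mg a b : FreeMonoid A,
    IsLeadingWord f mf → IsLeadingWord g mg → mf * b = a * mg →
    (mf * b).length < mf.length + mg.length →
    IsTrivialMod R (mf * b) (f * mon F b - mon F a * g)
  inclusion : ∀ f ∈ R, ∀ g ∈ R, ∀ mf mg a b : FreeMonoid A,
    IsLeadingWord f mf → IsLeadingWord g mg → mf = a * mg * b →
    IsTrivialMod R mf (f - mon F a * g * mon F b)

/-- A set of relations `u = v` is a Gröbner–Shirshov basis: `u > v` in the deg-lex ordering for
each relation, and the polynomials `u - v` form a Gröbner–Shirshov basis in `F⟨A⟩`. -/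
def RelIsGroebnerShirshov (F : Type v) {A : Type u} [Field F] [LinearOrder A]
    (R : Set (FreeSemigroup A × FreeSemigroup A)) : Prop :=
  (∀ p ∈ R, degLex (FreeMonoid.ofList (letters p.2)) (FreeMonoid.ofList (letters p.1))) ∧
  IsGroebnerShirshov {f : FreeAlg F A | ∃ p ∈ R,
    f = mon F (FreeMonoid.ofList (letters p.1)) - mon F (FreeMonoid.ofList (letters p.2))}

end AutoSgp

/-! Write the relation as `u ++ [l] = [x, y]` with `n` the length of `u`. Being a Gröbner–Shirshov
basis, it gives a confluent terminating rewriting rule (`overlapsResolve_of_groebner`,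
`exists_normalForm`), so the words avoiding `u ++ [l]` are unique normal forms, and they form a
regular prefix-closed language.

Multiply a normal word `s` on the right by a letter `a`. If `a ≠ l`, nothing is rewritten. If `a = l
≠ x`, at most one rewriting occurs, at the end of `s`, because the relation's left side does not end
in `xy`. If `a = l = x`, the rewriting cascades: for `s = t uᵐ` with `m` maximal the result is `t x
yᵐ`.

The lengths of `t uᵐ` and `t x yᵐ` can drift apart, so normal words are recoded over an alphabet of
blocks. Words are cut into pieces of `n` letters, but after a block `yⁿ` every further `y` is a
block by itself. Then `uᵐ` and `yᵐ` both cost `m` blocks up to a constant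
(`length_blocks_power_le`), provided `u ≠ yⁿ`, which is what the hypothesis on `y^(k-1) x` supplies.
Two outputs that stay in step form a regular padded relation (`isRegular_padRel_of_boundedDelay`),
and multiplication by a block is a composition of multiplications by letters
(`isRegular_padRel_comp`).

Prefixes of encoded normal words are again encoded normal words, so once an identity is adjoined the
prefix condition reduces to the equality condition. -/

namespace AutoSgp

/-! ### Regularity from finitely many residual languages -/

/-- Myhill–Nerode in a form that avoids automata: every left quotient of `L` is the union of the
members of `K` that it contains, so there are only finitely many quotients. -/
theorem isRegular_of_finite_cover {α : Type*} {L : Language α} (K : Set (Language α))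
    (hK : K.Finite)
    (h : ∀ v z, v ++ z ∈ L → ∃ M ∈ K, z ∈ M ∧ ∀ z' ∈ M, v ++ z' ∈ L) : L.IsRegular := by
  refine .of_finite_range_leftQuotient
    ((hK.finite_subsets.image fun s : Set (Set (List α)) => (⋃₀ s : Set (List α))).subset ?_)
  rintro _ ⟨v, rfl⟩
  refine ⟨{M ∈ K | ∀ z' ∈ M, v ++ z' ∈ L}, fun M hM => hM.1, ?_⟩
  ext z
  constructor
  · rintro ⟨M, hM, hz⟩
    exact hM.2 z hz
  · intro hz
    obtain ⟨M, hM, hzM, hM'⟩ := h v z hz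
    exact ⟨M, ⟨hM, hM'⟩, hzM⟩

theorem isRegular_singleton {α : Type*} (w : List α) :
    Language.IsRegular ({w} : Set (List α)) := by
  refine isRegular_of_finite_cover ((fun t : List α => ({t} : Set (List α))) '' {t | t <:+ w})
    ((List.finite_toSet w.tails).subset (by intro t ht; simpa using ht) |>.image _) ?_
  intro v z hz
  have hz : v ++ z = w := hz
  refine ⟨_, ⟨z, ⟨v, hz⟩, rfl⟩, rfl, ?_⟩
  rintro z' rfl
  exact hz

theorem isRegular_map {α β : Type*} (f : α → β) {L : Language α}
    (hL : L.IsRegular) : Language.IsRegular (List.map f '' L) := by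
  refine isRegular_of_finite_cover ((fun M : Language α => (List.map f '' M : Set (List β))) ''
    Set.range L.leftQuotient) (hL.finite_range_leftQuotient.image _) ?_
  rintro v z ⟨t, ht, htv⟩
  obtain ⟨t1, t2, rfl, rfl, rfl⟩ := List.map_eq_append_iff.1 htv
  refine ⟨_, ⟨_, ⟨t1, rfl⟩, rfl⟩, ⟨t2, ht, rfl⟩, ?_⟩
  rintro _ ⟨t3, ht3, rfl⟩
  exact ⟨t1 ++ t3, ht3, by simp⟩

theorem isRegular_comap_map {α β : Type*} (f : α → β) {L : Language β}
    (hL : L.IsRegular) : Language.IsRegular (List.map f ⁻¹' L) := by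
  refine isRegular_of_finite_cover ((fun M : Language β => (List.map f ⁻¹' M : Set (List α))) ''
    Set.range L.leftQuotient) (hL.finite_range_leftQuotient.image _) ?_
  intro v z hz
  refine ⟨_, ⟨_, ⟨v.map f, rfl⟩, rfl⟩, ?_, ?_⟩
  · have h : (v ++ z).map f ∈ L := hz
    rw [List.map_append] at h
    exact h
  · intro z' hz'
    have h : v.map f ++ z'.map f ∈ L := hz'
    rw [← List.map_append] at h
    exact h

theorem isRegular_comap_flatMap {α β : Type*} (f : α → List β) {L : Language β}
    (hL : L.IsRegular) : Language.IsRegular {c : List α | c.flatMap f ∈ L} := by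
  refine isRegular_of_finite_cover ((fun M : Language β => ({c | c.flatMap f ∈ M} : Set (List α))) ''
    Set.range L.leftQuotient) (hL.finite_range_leftQuotient.image _) ?_
  intro v z hz
  refine ⟨_, ⟨_, ⟨v.flatMap f, rfl⟩, rfl⟩, ?_, ?_⟩
  · have h : (v ++ z).flatMap f ∈ L := hz
    rw [List.flatMap_append] at h
    exact h
  · intro z' hz'
    have h : v.flatMap f ++ z'.flatMap f ∈ L := hz'
    rw [← List.flatMap_append] at h
    exact h

/-! ### Padding -/

section Pad

variable {B : Type*}

theorem padRight_filterMap_fst : ∀ s t : List B, (padRight s t).filterMap (fun p => p.1.1) = s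
  | [], [] => by simp [padRight]
  | a :: s, [] => by simp [padRight, padRight_filterMap_fst s []]
  | [], b :: t => by simp [padRight, padRight_filterMap_fst [] t]
  | a :: s, b :: t => by simp [padRight, padRight_filterMap_fst s t]

theorem padRight_filterMap_snd : ∀ s t : List B, (padRight s t).filterMap (fun p => p.1.2) = t
  | [], [] => by simp [padRight]
  | a :: s, [] => by simp [padRight, padRight_filterMap_snd s []]
  | [], b :: t => by simp [padRight, padRight_filterMap_snd [] t]
  | a :: s, b :: t => by simp [padRight, padRight_filterMap_snd s t]

theorem padRight_inj {s t s' t' : List B} (h : padRight s t = padRight s' t') :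
    s = s' ∧ t = t' := by
  constructor
  · rw [← padRight_filterMap_fst s t, h, padRight_filterMap_fst]
  · rw [← padRight_filterMap_snd s t, h, padRight_filterMap_snd]

theorem length_padRight : ∀ s t : List B, (padRight s t).length = max s.length t.length
  | [], [] => by simp [padRight]
  | a :: s, [] => by simp [padRight, length_padRight s []]
  | [], b :: t => by simp [padRight, length_padRight [] t]
  | a :: s, b :: t => by simp [padRight, length_padRight s t]

theorem padRight_take_drop (N : ℕ) : ∀ s t : List B,
    padRight s t = padRight (s.take N) (t.take N) ++ padRight (s.drop N) (t.drop N) := by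
  induction N with
  | zero => simp [padRight]
  | succ N ih =>
    rintro (_ | ⟨a, s⟩) (_ | ⟨b, t⟩)
    · simp [padRight]
    · simpa [padRight] using ih [] t
    · simpa [padRight] using ih s []
    · simpa [padRight] using ih s t

theorem padRight_eq_append {s t : List B} {v z : List (PadAlphabet B)} (h : v ++ z = padRight s t) :
    v = padRight (s.take v.length) (t.take v.length) ∧
      z = padRight (s.drop v.length) (t.drop v.length) := by
  have h1 := congrArg List.length h
  rw [length_padRight, List.length_append] at h1
  rw [padRight_take_drop v.length s t] at h
  refine List.append_inj h ?_
  rw [length_padRight, List.length_take, List.length_take]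
  omega

/-- Padding is compatible with cutting at position `N` only if a word that ends before `N` has
nothing left after it; the hypotheses express this. -/
theorem padRight_append {N : ℕ} {s₁ s₂ t₁ t₂ : List B}
    (hs : s₁.length ≤ N ∧ (s₁.length < N → s₂ = []))
    (ht : t₁.length ≤ N ∧ (t₁.length < N → t₂ = [])) :
    padRight (s₁ ++ s₂) (t₁ ++ t₂) = padRight s₁ t₁ ++ padRight s₂ t₂ := by
  have key : ∀ {l₁ l₂ : List B}, l₁.length ≤ N ∧ (l₁.length < N → l₂ = []) →
      (l₁ ++ l₂).take N = l₁ ∧ (l₁ ++ l₂).drop N = l₂ := by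
    rintro l₁ l₂ ⟨h1, h2⟩
    rcases h1.lt_or_eq with h | rfl
    · simp [h2 h, h1]
    · simp
  rw [padRight_take_drop N, (key hs).1, (key hs).2, (key ht).1, (key ht).2]

theorem padRight_self (s : List B) :
    padRight s s = s.map fun b => (⟨(some b, some b), by simp⟩ : PadAlphabet B) := by
  induction s with
  | nil => simp [padRight]
  | cons a s ih => simp [padRight, ih]

/-- The language of padded pairs of a relation between possibly empty words. -/
def padRel (U : Set (List B × List B)) : Language (PadAlphabet B) :=
  (fun p => padRight p.1 p.2) '' U

theorem mem_padRel {U : Set (List B × List B)} {s t : List B} :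
    padRight s t ∈ padRel U ↔ (s, t) ∈ U := by
  constructor
  · rintro ⟨⟨s', t'⟩, h, h'⟩
    obtain ⟨rfl, rfl⟩ := padRight_inj h'
    exact h
  · exact fun h => ⟨_, h, rfl⟩

theorem isRegular_padRel_union {U V : Set (List B × List B)} (hU : (padRel U).IsRegular)
    (hV : (padRel V).IsRegular) : (padRel (U ∪ V)).IsRegular := by
  have : padRel (U ∪ V) = padRel U + padRel V := Set.image_union _ _ _
  rw [this]
  exact hU.add hV

theorem isRegular_padRel_singleton (s t : List B) : (padRel {(s, t)}).IsRegular := by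
  have : padRel {(s, t)} = ({padRight s t} : Set (List (PadAlphabet B))) := Set.image_singleton
  rw [this]
  exact isRegular_singleton _

theorem isRegular_of_padRel_diag {L : Set (List B)}
    (h : (padRel {p | p.1 ∈ L ∧ p.2 = p.1}).IsRegular) : Language.IsRegular L := by
  have := isRegular_comap_map
    (fun b : B => (⟨(some b, some b), by simp⟩ : PadAlphabet B)) h
  refine (congrArg Language.IsRegular (Set.ext fun s => ?_)).mp this
  constructor
  · intro hs
    have hs : s.map _ ∈ padRel _ := hs
    rw [← padRight_self] at hs
    exact (mem_padRel.1 hs).1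
  · intro hs
    show s.map _ ∈ padRel _
    rw [← padRight_self]
    exact mem_padRel.2 ⟨hs, rfl⟩

/-- The letterwise action of a map of alphabets on padded pairs. -/
def padMap {C : Type*} (f : B → C) (p : PadAlphabet B) : PadAlphabet C :=
  ⟨(p.1.1.map f, p.1.2.map f), by
    have := p.2
    rcases p with ⟨⟨_ | a, _ | b⟩, h⟩ <;> simp_all⟩

theorem map_padMap {C : Type*} (f : B → C) : ∀ s t : List B,
    (padRight s t).map (padMap f) = padRight (s.map f) (t.map f)
  | [], [] => by simp [padRight]
  | a :: s, [] => by simpa [padRight, padMap] using map_padMap f s []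
  | [], b :: t => by simpa [padRight, padMap] using map_padMap f [] t
  | a :: s, b :: t => by simpa [padRight, padMap] using map_padMap f s t

theorem isRegular_padRel_map {C : Type*} (f : B → C)
    {U : Set (List B × List B)} (hU : (padRel U).IsRegular) :
    (padRel ((fun p => (p.1.map f, p.2.map f)) '' U)).IsRegular := by
  convert isRegular_map (padMap f) hU using 1
  simp only [padRel, Set.image_image, map_padMap]

/-- Synchronously regular relations are closed under composition. -/
theorem isRegular_padRel_comp {U V : Set (List B × List B)} (hU : (padRel U).IsRegular)
    (hV : (padRel V).IsRegular) :
    (padRel {p | ∃ t, (p.1, t) ∈ U ∧ (t, p.2) ∈ V}).IsRegular := by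
  -- The middle word `s` is guessed. After `N` letters it suffices to know the quotients of the two
  -- relations and which of the three words have already ended.
  let K : (Prop × Prop × Prop) × (Language (PadAlphabet B) × Language (PadAlphabet B)) →
      Language (PadAlphabet B) := fun q =>
    {z | ∃ r s t : List B, z = padRight r t ∧ (q.1.1 → r = []) ∧ (q.1.2.1 → s = []) ∧
      (q.1.2.2 → t = []) ∧ padRight r s ∈ q.2.1 ∧ padRight s t ∈ q.2.2}
  refine isRegular_of_finite_cover (K '' (Set.univ ×ˢ
    (Set.range (padRel U).leftQuotient ×ˢ Set.range (padRel V).leftQuotient)))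
    ((Set.finite_univ.prod
      (hU.finite_range_leftQuotient.prod hV.finite_range_leftQuotient)).image _) ?_
  rintro v z ⟨⟨r, t⟩, ⟨s, h1, h2⟩, hz⟩
  set N := v.length with hN
  obtain ⟨hv, hz⟩ := padRight_eq_append hz.symm
  have hsplit : ∀ l : List B, (l.take N).length ≤ N ∧ ((l.take N).length < N → l.drop N = []) := by
    intro l
    simp
    omega
  refine ⟨_, ⟨((r.length < N, s.length < N, t.length < N),
    (padRel U).leftQuotient (padRight (r.take N) (s.take N)),
    (padRel V).leftQuotient (padRight (s.take N) (t.take N))),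
    ⟨trivial, ⟨_, rfl⟩, ⟨_, rfl⟩⟩, rfl⟩, ?_, ?_⟩
  · refine ⟨r.drop N, s.drop N, t.drop N, hz, ?_, ?_, ?_, ?_, ?_⟩
    · intro h; simpa using (show r.length < N from h).le
    · intro h; simpa using (show s.length < N from h).le
    · intro h; simpa using (show t.length < N from h).le
    · simp only [Language.mem_leftQuotient, ← padRight_take_drop]
      exact mem_padRel.2 h1
    · simp only [Language.mem_leftQuotient, ← padRight_take_drop]
      exact mem_padRel.2 h2
  · rintro _ ⟨r', s', t', rfl, hr, hs, ht, h3, h4⟩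
    have glue : ∀ {l l' : List B}, (l.length < N → l' = []) →
        (l.take N).length ≤ N ∧ ((l.take N).length < N → l' = []) := by
      intro l l' h
      refine ⟨by simp, fun h' => h ?_⟩
      simp at h'
      omega
    rw [hv, ← padRight_append (glue hr) (glue ht), mem_padRel]
    rw [Language.mem_leftQuotient, ← padRight_append (glue hr) (glue hs), mem_padRel] at h3
    rw [Language.mem_leftQuotient, ← padRight_append (glue hs) (glue ht), mem_padRel] at h4
    exact ⟨_, h3, h4⟩

end Pad

/-! ### Pairs of words produced by two deterministic transducers with bounded delay -/

/-- `F₁`, `F₂` are the outputs already fixed after reading `c`, `G₁`, `G₂` the complete outputs if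
the input stops there, and `r₁`, `r₂` what remains to be written from a given state. Since the fixed
outputs stay within `D` of each other, the future of a padded pair depends only on the state, a
quotient of `P` and two overhanging words of length at most `2 * D`. -/
theorem isRegular_padRel_of_boundedDelay {B C σ : Type*} [Finite B]
    {P : Set (List C)} (hP : Language.IsRegular P) (st : List C → σ) (hst : (Set.range st).Finite)
    (F₁ F₂ G₁ G₂ : List C → List B) (r₁ r₂ : σ → List C → List B) (D : ℕ)
    (h₁ : ∀ c d, G₁ (c ++ d) = F₁ c ++ r₁ (st c) d) (h₂ : ∀ c d, G₂ (c ++ d) = F₂ c ++ r₂ (st c) d)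
    (hF₁ : F₁ [] = []) (hF₂ : F₂ [] = [])
    (hs₁ : ∀ c a, (F₁ (c ++ [a])).length ≤ (F₁ c).length + D)
    (hs₂ : ∀ c a, (F₂ (c ++ [a])).length ≤ (F₂ c).length + D)
    (hG₁ : ∀ c, (G₁ c).length ≤ (F₁ c).length + D) (hG₂ : ∀ c, (G₂ c).length ≤ (F₂ c).length + D)
    (hd : ∀ c d, c ++ d ∈ P →
      (F₁ c).length ≤ (F₂ c).length + D ∧ (F₂ c).length ≤ (F₁ c).length + D) :
    (padRel ((fun c => (G₁ c, G₂ c)) '' P)).IsRegular := by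
  let S : Set (List B) := {l | l.length ≤ 2 * D}
  have hmem : ∀ {l : List B}, l.length ≤ 2 * D → l ∈ S := fun h => h
  have hS : S.Finite := List.finite_length_le B (2 * D)
  let P' : Language C := P
  let K : (σ × Language C) × (List B × List B) → Language (PadAlphabet B) := fun q =>
    {z | ∃ d ∈ q.1.2, z = padRight (q.2.1 ++ r₁ q.1.1 d) (q.2.2 ++ r₂ q.1.1 d)}
  let K' : List B × List B → Language (PadAlphabet B) := fun q => {padRight q.1 q.2}
  refine isRegular_of_finite_cover
    (K '' ((Set.range st ×ˢ Set.range P'.leftQuotient) ×ˢ (S ×ˢ S)) ∪ K' '' (S ×ˢ S))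
    ((((hst.prod hP.finite_range_leftQuotient).prod (hS.prod hS)).image _).union
      ((hS.prod hS).image _)) ?_
  rintro v z ⟨_, ⟨c, hc, rfl⟩, hz⟩
  set N := v.length with hN
  obtain ⟨hv, hz'⟩ := padRight_eq_append hz.symm
  rw [← hN] at hv hz'
  by_cases hlong : N ≤ (F₁ c).length ∧ N ≤ (F₂ c).length
  -- Stop as soon as both fixed outputs cover `N` letters. One letter earlier one of them was
  -- shorter than `N`, so the other was below `N + D`, and a single step adds at most `D`.
  · obtain ⟨c₁, d, rfl, hl₁, hl₂, hu₁, hu₂⟩ : ∃ c₁ d, c = c₁ ++ d ∧ N ≤ (F₁ c₁).length ∧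
        N ≤ (F₂ c₁).length ∧ (F₁ c₁).length ≤ N + 2 * D ∧ (F₂ c₁).length ≤ N + 2 * D := by
      have aux : ∀ c₀ d, c₀ ++ d ∈ P → N ≤ (F₁ c₀).length ∧ N ≤ (F₂ c₀).length →
          ∃ c₁ d₁, c₀ = c₁ ++ d₁ ∧ N ≤ (F₁ c₁).length ∧
          N ≤ (F₂ c₁).length ∧ (F₁ c₁).length ≤ N + 2 * D ∧ (F₂ c₁).length ≤ N + 2 * D := by
        intro c₀
        induction c₀ using List.reverseRecOn with
        | nil =>
          intro d _ h
          exact ⟨[], [], rfl, h.1, h.2, by simp [hF₁], by simp [hF₂]⟩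
        | append_singleton c₀ a ih =>
          intro d hd' h
          by_cases hlong : N ≤ (F₁ c₀).length ∧ N ≤ (F₂ c₀).length
          · obtain ⟨c₁, d₁, rfl, h'⟩ := ih ([a] ++ d) (by simpa using hd') hlong
            exact ⟨c₁, d₁ ++ [a], by simp, h'⟩
          · have h3 := hd c₀ ([a] ++ d) (by simpa using hd')
            have h4 := hs₁ c₀ a
            have h5 := hs₂ c₀ a
            exact ⟨c₀ ++ [a], [], by simp, h.1, h.2, by omega, by omega⟩
      obtain ⟨c₁, d₁, rfl, h'⟩ := aux c [] (by simpa using hc) hlong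
      exact ⟨c₁, d₁, rfl, h'⟩
    have e₁ : ∀ l, (F₁ c₁).take N ++ ((F₁ c₁).drop N ++ l) = F₁ c₁ ++ l := by
      intro l; rw [← List.append_assoc, List.take_append_drop]
    have e₂ : ∀ l, (F₂ c₁).take N ++ ((F₂ c₁).drop N ++ l) = F₂ c₁ ++ l := by
      intro l; rw [← List.append_assoc, List.take_append_drop]
    simp only [h₁, h₂, List.take_append_of_le_length hl₁, List.take_append_of_le_length hl₂,
      List.drop_append_of_le_length hl₁, List.drop_append_of_le_length hl₂] at hv hz'
    refine ⟨_, Or.inl ⟨((st c₁, P'.leftQuotient c₁), ((F₁ c₁).drop N, (F₂ c₁).drop N)),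
      ⟨⟨⟨_, rfl⟩, ⟨_, rfl⟩⟩, ?_, ?_⟩, rfl⟩, ⟨d, hc, hz'⟩, ?_⟩
    · refine hmem ?_
      rw [List.length_drop]; omega
    · refine hmem ?_
      rw [List.length_drop]; omega
    · rintro _ ⟨d', hd', rfl⟩
      refine ⟨_, ⟨c₁ ++ d', hd', rfl⟩, ?_⟩
      simp only [h₁, h₂]
      rw [← e₁, ← e₂, hv]
      exact padRight_append (N := N) (by simp; omega) (by simp; omega)
  -- Some fixed output never reaches `N`, so both complete outputs are shorter than `N + 2 * D`, or
  -- at most that long, and only a bounded pair of words is left.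
  · have h3 := hd c [] (by simpa using hc)
    have h4 := hG₁ c
    have h5 := hG₂ c
    refine ⟨_, Or.inr ⟨((G₁ c).drop N, (G₂ c).drop N), ⟨?_, ?_⟩, rfl⟩, hz', ?_⟩
    · refine hmem ?_
      rw [List.length_drop]; omega
    · refine hmem ?_
      rw [List.length_drop]; omega
    · rintro z' hz2
      have hz2 : z' = padRight ((G₁ c).drop N) ((G₂ c).drop N) := hz2
      rw [hz2, ← hz', ← hz]
      exact ⟨_, ⟨c, hc, rfl⟩, rfl⟩

/-! ### Cutting words into blocks

A word is cut from the left into blocks of `n` letters, except that the letters `y` which directly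
follow a block `yⁿ` form blocks of their own.  The state of the cutting procedure consists of the
letters that are waiting for their block to be completed, and of a flag which says that the letters
read last are `yⁿ` and that a block ends here. -/

section Encoder

variable {A : Type*} [DecidableEq A] (n : ℕ) (y : A)

/-- Whether a block is completed by reading `a`. -/
def cuts (s : List A × Bool) (a : A) : Prop := (s.2 = true ∧ a = y) ∨ s.1.length + 1 = n

instance (s : List A × Bool) (a : A) : Decidable (cuts n y s a) :=
  inferInstanceAs (Decidable (_ ∨ _))

/-- The state after reading `a`. -/
def nextState (s : List A × Bool) (a : A) : List A × Bool :=
  if cuts n y s a then ([], decide ((s.2 = true ∧ a = y) ∨ s.1 ++ [a] = List.replicate n y))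
  else (s.1 ++ [a], false)

/-- The state after reading a word. -/
def finalState (s : List A × Bool) (l : List A) : List A × Bool := l.foldl (nextState n y) s

/-- The blocks completed while reading a word. -/
def blocks (s : List A × Bool) : List A → List (List A)
  | [] => []
  | a :: l => (if cuts n y s a then [s.1 ++ [a]] else []) ++ blocks (nextState n y s a) l

/-- The block formed by the waiting letters. -/
def flush (s : List A × Bool) : List (List A) := if s.1 = [] then [] else [s.1]

/-- The sequence of all blocks of a word. -/
def encodeFrom (s : List A × Bool) (l : List A) : List (List A) :=
  blocks n y s l ++ flush (finalState n y s l)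

variable {n y}

@[simp] theorem finalState_nil (s : List A × Bool) : finalState n y s [] = s := rfl

@[simp] theorem finalState_cons (s : List A × Bool) (a : A) (l : List A) :
    finalState n y s (a :: l) = finalState n y (nextState n y s a) l := rfl

theorem finalState_append (s : List A × Bool) (l m : List A) :
    finalState n y s (l ++ m) = finalState n y (finalState n y s l) m := List.foldl_append

theorem blocks_append (s : List A × Bool) (l m : List A) :
    blocks n y s (l ++ m) = blocks n y s l ++ blocks n y (finalState n y s l) m := by
  induction l generalizing s with
  | nil => simp [blocks]
  | cons a l ih => simp [blocks, ih]

theorem encodeFrom_append (s : List A × Bool) (l m : List A) :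
    encodeFrom n y s (l ++ m) = blocks n y s l ++ encodeFrom n y (finalState n y s l) m := by
  simp [encodeFrom, blocks_append, finalState_append]

theorem encodeFrom_cons (s : List A × Bool) (a : A) (l : List A) :
    encodeFrom n y s (a :: l) =
      (if cuts n y s a then [s.1 ++ [a]] else []) ++ encodeFrom n y (nextState n y s a) l := by
  simp [encodeFrom, blocks]

theorem flatten_blocks (s : List A × Bool) (l : List A) :
    (blocks n y s l).flatten ++ (finalState n y s l).1 = s.1 ++ l := by
  induction l generalizing s with
  | nil => simp [blocks]
  | cons a l ih =>
    rw [blocks, List.flatten_append, List.append_assoc, finalState_cons, ih, nextState]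
    split_ifs <;> simp

theorem flatten_encodeFrom (s : List A × Bool) (l : List A) :
    (encodeFrom n y s l).flatten = s.1 ++ l := by
  rw [← flatten_blocks (n := n) (y := y) s l, encodeFrom, flush, List.flatten_append]
  split_ifs with h <;> simp [h]

theorem length_nextState_lt (hn : 0 < n) {s : List A × Bool} (hs : s.1.length < n) (a : A) :
    (nextState n y s a).1.length < n := by
  rw [nextState]
  split_ifs with h
  · exact hn
  · simp only [cuts, not_or] at h
    simp only [List.length_append, List.length_singleton]
    omega

theorem length_finalState_lt (hn : 0 < n) {s : List A × Bool} (hs : s.1.length < n) (l : List A) :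
    (finalState n y s l).1.length < n := by
  induction l generalizing s with
  | nil => exact hs
  | cons a l ih => exact ih (length_nextState_lt hn hs a)

theorem mem_encodeFrom (hn : 0 < n) {s : List A × Bool} (hs : s.1.length < n) (l : List A)
    {b : List A} (hb : b ∈ encodeFrom n y s l) : b ≠ [] ∧ b.length ≤ n := by
  induction l generalizing s with
  | nil =>
    simp only [encodeFrom, blocks, finalState_nil, List.nil_append] at hb
    unfold flush at hb
    by_cases h : s.1 = []
    · simp [h] at hb
    · rw [if_neg h] at hb
      obtain rfl := List.mem_singleton.1 hb
      exact ⟨h, hs.le⟩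
  | cons a l ih =>
    rw [encodeFrom_cons, List.mem_append] at hb
    rcases hb with hb | hb
    · split_ifs at hb with h
      · obtain rfl := List.mem_singleton.1 hb
        exact ⟨by simp, by simpa using hs⟩
      · simp at hb
    · exact ih (length_nextState_lt hn hs a) hb

theorem length_blocks_le (s : List A × Bool) (l : List A) :
    (blocks n y s l).length ≤ l.length := by
  induction l generalizing s with
  | nil => simp [blocks]
  | cons a l ih =>
    have := ih (nextState n y s a)
    rw [blocks, List.length_append, List.length_cons]
    split_ifs <;> simp <;> omega

theorem length_encodeFrom_le (s : List A × Bool) (l : List A) :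
    (encodeFrom n y s l).length ≤ (blocks n y s l).length + 1 := by
  rw [encodeFrom, List.length_append, flush]
  split_ifs <;> simp

/-- A nonempty prefix of an encoded word encodes a prefix of the word. -/
theorem exists_encodeFrom_eq_of_prefix (s : List A × Bool) (l : List A) {p : List (List A)}
    (hp : p <+: encodeFrom n y s l) (hne : p ≠ []) : ∃ l', l' <+: l ∧ encodeFrom n y s l' = p := by
  induction l generalizing s p with
  | nil =>
    -- Without further input the encoding has at most one block, so a nonempty prefix is all of it.
    refine ⟨[], List.prefix_rfl, ?_⟩
    refine (hp.eq_of_length_le ?_).symm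
    have := length_encodeFrom_le (n := n) (y := y) s []
    have := List.length_pos_iff.2 hne
    simp only [blocks, List.length_nil] at *
    omega
  | cons a l ih =>
    rw [encodeFrom_cons] at hp
    split_ifs at hp with h
    · obtain ⟨b, p, rfl⟩ := List.exists_cons_of_ne_nil hne
      rw [List.singleton_append, List.cons_prefix_cons] at hp
      obtain ⟨rfl, hp⟩ := hp
      rcases eq_or_ne p [] with rfl | hne'
      · refine ⟨[a], by simp, ?_⟩
        simp [encodeFrom, blocks, h, nextState, flush]
      · obtain ⟨l', hl', rfl⟩ := ih _ hp hne'
        exact ⟨a :: l', by simpa using hl', by simp [encodeFrom_cons, h]⟩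
    · obtain ⟨l', hl', rfl⟩ := ih _ hp hne
      exact ⟨a :: l', by simpa using hl', by simp [encodeFrom_cons, h]⟩

/-- The flag is raised by a completed block `yⁿ` and kept only by a further `y`, after which the
last `n` letters are still `yⁿ`. -/
theorem suffix_of_flag (l : List A) (h : (finalState n y ([], false) l).2 = true) :
    List.replicate n y <:+ l := by
  induction l using List.reverseRecOn with
  | nil => simp at h
  | append_singleton l a ih =>
    have hf := flatten_blocks (n := n) (y := y) ([], false) l
    rw [finalState_append, finalState_cons, finalState_nil, nextState] at h
    split_ifs at h with hc
    · simp only [decide_eq_true_eq] at h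
      rcases h with ⟨h, rfl⟩ | h
      · obtain ⟨k, hk⟩ := ih h
        refine ⟨k ++ [a], ?_⟩
        rw [← hk, List.append_assoc, List.append_assoc, ← List.replicate_succ',
          List.replicate_succ, List.singleton_append]
      · rw [← h]
        refine ⟨(blocks n y ([], false) l).flatten, ?_⟩
        rw [← List.append_assoc, hf, List.nil_append]

/-- While no letter forms a block of its own, every block has `n` letters. -/
theorem length_blocks_of_not_flag {s : List A × Bool} {l : List A}
    (h : ∀ t, t <+: l → t ≠ l → (finalState n y s t).2 = false) :
    n * (blocks n y s l).length + (finalState n y s l).1.length = s.1.length + l.length := by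
  induction l generalizing s with
  | nil => simp [blocks]
  | cons a l ih =>
    have h0 : s.2 = false := h [] (by simp) (by simp)
    have := ih (s := nextState n y s a) fun t ht hne =>
      h (a :: t) (by simpa using ht) (by simpa using hne)
    rw [blocks, finalState_cons, List.length_append, Nat.mul_add, Nat.add_assoc, this, nextState]
    by_cases hc : cuts n y s a
    · have hc' := hc
      simp only [cuts, h0, Bool.false_eq_true, false_and, false_or] at hc'
      simp [hc]
      omega
    · simp [hc]
      omega

/-- The length of the encoding of `uᵐ` grows by one with each `u` but the first. -/
theorem length_blocks_power (hn : 0 < n) {u : List A} (hu : u.length = n)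
    (hne : u ≠ List.replicate n y) (l : List A) (m : ℕ) :
    (blocks n y ([], false) (l ++ u ++ (List.replicate m u).flatten)).length =
      (blocks n y ([], false) (l ++ u)).length + m := by
  induction m with
  | zero => simp
  | succ m ih =>
    obtain ⟨k, hk⟩ : ∃ k, l ++ u ++ (List.replicate m u).flatten = k ++ u := by
      cases m with
      | zero => exact ⟨l, by simp⟩
      | succ m => exact ⟨l ++ u ++ (List.replicate m u).flatten, by
          rw [List.replicate_succ']; simp⟩
    rw [List.replicate_succ', List.flatten_append, ← List.append_assoc, hk, blocks_append]
    rw [hk] at ih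
    rw [List.length_append, ih, Nat.add_assoc]
    congr 2
    -- Inside a copy of `u = t t'` that follows another copy, the last `n` letters read are the
    -- rotation `t' t`. If the flag were up, this would be `yⁿ`, and then so would `u`. The first
    -- copy is excluded because the letters before it are arbitrary.
    have hflag : ∀ t, t <+: u → (finalState n y (finalState n y ([], false) (k ++ u)) t).2 = false := by
      rintro t ⟨t', rfl⟩
      rw [← finalState_append]
      by_contra hflag
      have hs := suffix_of_flag (n := n) (y := y) (k ++ (t ++ t') ++ t) (by simpa using hflag)
      have hlen : (t' ++ t).length = n := by rw [← hu]; simp; omega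
      have hs' : t' ++ t <:+ k ++ (t ++ t') ++ t := ⟨k ++ t, by simp⟩
      have heq : t' ++ t = List.replicate n y :=
        (List.suffix_of_suffix_length_le hs' hs (by rw [hlen]; simp)).eq_of_length
          (by rw [hlen]; simp)
      apply hne
      rw [List.eq_replicate_iff]
      refine ⟨hu, fun b hb => ?_⟩
      have : b ∈ t' ++ t := by simp at hb ⊢; tauto
      rw [heq] at this
      exact List.eq_of_mem_replicate this
    have h := length_blocks_of_not_flag fun t ht _ => hflag t ht
    have h1 := length_finalState_lt (y := y) hn (s := ([], false)) hn (k ++ u)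
    have h2 := length_finalState_lt (y := y) hn h1 u
    simp only [List.flatten_cons, List.flatten_nil, List.append_nil]
    rw [hu] at h
    set b := (blocks n y (finalState n y ([], false) (k ++ u)) u).length
    have hb1 : b < 2 := by
      by_contra hb
      nlinarith [Nat.mul_le_mul_left n (not_lt.1 hb)]
    have hb0 : b ≠ 0 := by
      rintro hb
      rw [hb] at h
      omega
    omega

/-- After boundedly many letters `y`, every letter `y` is a block. -/
theorem le_length_blocks_replicate {s : List A × Bool} (hs : s.1.length < n) (m : ℕ) :
    m ≤ (blocks n y s (List.replicate m y)).length + 2 * n := by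
  classical
  -- The potential bounds the number of letters `y` needed to raise the flag: fill up the current
  -- block, and if it already contains another letter, complete one more block `yⁿ`. Each `y` either
  -- completes a block without raising the potential or lowers the potential by one.
  let pot : List A × Bool → ℕ := fun s => if s.2 = true then 0 else
    if s.1 = List.replicate s.1.length y then n - s.1.length else 2 * n - s.1.length
  have hpot : pot s ≤ 2 * n := by
    simp only [pot]
    split_ifs <;> omega
  suffices h : m ≤ (blocks n y s (List.replicate m y)).length + pot s by omega
  clear hpot
  induction m generalizing s with
  | zero => simp
  | succ m ih =>
    have h1 := ih (s := nextState n y s y) (length_nextState_lt (by omega) hs y)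
    rw [List.replicate_succ, blocks, List.length_append]
    suffices h : pot (nextState n y s y) + 1 ≤
        (if cuts n y s y then [s.1 ++ [y]] else []).length + pot s by omega
    obtain ⟨l, f⟩ := s
    cases f
    · by_cases hl : l = List.replicate l.length y
      · have hl' : l ++ [y] = List.replicate (l.length + 1) y := by
          rw [List.replicate_succ', ← hl]
        by_cases hc : l.length + 1 = n
        · rw [hc] at hl'
          simp [pot, nextState, cuts, hc, hl', ← hl]
        · simp at hs
          simp [pot, nextState, cuts, hc, ← hl, ← hl']
          omega
      · have hl' : ∀ k, l ++ [y] ≠ List.replicate k y := by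
          intro k hk
          apply hl
          rw [List.eq_replicate_iff] at hk ⊢
          exact ⟨rfl, fun b hb => hk.2 b (by simp [hb])⟩
        simp at hs
        by_cases hc : l.length + 1 = n
        · simp [pot, nextState, cuts, hc, hl', hl]
          omega
        · simp [pot, nextState, cuts, hc, hl', hl]
          omega
    · simp [pot, nextState, cuts]

/-- Appending powers of `u` and of `y` changes the length of the encoding in step. -/
theorem length_blocks_power_le (hn : 0 < n) {u : List A} (hu : u.length = n)
    (hne : u ≠ List.replicate n y) (x : A) (l : List A) (m : ℕ) :
    (blocks n y ([], false) (l ++ (List.replicate m u).flatten)).length ≤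
      (blocks n y ([], false) (l ++ [x] ++ List.replicate m y)).length + (3 * n + 2) ∧
    (blocks n y ([], false) (l ++ [x] ++ List.replicate m y)).length ≤
      (blocks n y ([], false) (l ++ (List.replicate m u).flatten)).length + (3 * n + 2) := by
  -- The slack covers at most `2 * n` letters `y` that yield no block, at most `n` blocks completed
  -- by the first `u`, and at most one completed by `x`.
  have h1 := le_length_blocks_replicate (y := y)
    (length_finalState_lt (y := y) hn (s := ([], false)) hn (l ++ [x])) m
  have h2 := length_blocks_le (n := n) (y := y)
    (finalState n y ([], false) (l ++ [x])) (List.replicate m y)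
  have h3 := length_blocks_le (n := n) (y := y) (finalState n y ([], false) l) [x]
  simp only [List.length_replicate, List.length_singleton] at h2 h3
  rw [blocks_append _ (l ++ [x]), List.length_append, blocks_append _ l [x], List.length_append]
  cases m with
  | zero =>
    simp only [List.replicate_zero, List.flatten_nil, List.append_nil] at *
    omega
  | succ m =>
    have h4 := length_blocks_power hn hu hne l m
    have h5 := length_blocks_le (n := n) (y := y) (finalState n y ([], false) l) u
    rw [List.replicate_succ (a := u), List.flatten_cons, ← List.append_assoc, h4, blocks_append,
      List.length_append]
    omega

end Encoder

/-! ### Regularity of the encoded relations -/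

section Relations

variable {A : Type*}

/-- Appending a fixed word and then a power of a fixed word. -/
def appendPower (s p l : List A) (m : ℕ) : List A := l ++ s ++ (List.replicate m p).flatten

/-- Control words that drive both components at once: `inl a` writes a letter of the common prefix,
`inr false` inserts the fixed word of each side, and each `inr true` adds one copy of the word to be
repeated. -/
theorem isRegular_moves :
    Language.IsRegular {c : List (A ⊕ Bool) | ∃ (l : List A) (m : ℕ),
      c = l.map Sum.inl ++ Sum.inr false :: List.replicate m (Sum.inr true)} := by
  let M₁ : Language (A ⊕ Bool) := {c : List (A ⊕ Bool) | ∃ (l : List A) (m : ℕ),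
      c = l.map Sum.inl ++ Sum.inr false :: List.replicate m (Sum.inr true)}
  let M₂ : Language (A ⊕ Bool) := {c : List (A ⊕ Bool) | ∃ m : ℕ,
      c = List.replicate m (Sum.inr true)}
  refine isRegular_of_finite_cover {M₁, M₂} (by simp) ?_
  rintro v z ⟨l, m, h⟩
  rw [List.append_eq_append_iff] at h
  rcases h with ⟨t, h1, h2⟩ | ⟨t, h1, h2⟩
  · obtain ⟨l₁, l₂, rfl, rfl, rfl⟩ := List.map_eq_append_iff.1 h1
    refine ⟨M₁, by simp, ⟨l₂, m, h2⟩, ?_⟩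
    rintro _ ⟨l', m', rfl⟩
    exact ⟨l₁ ++ l', m', by simp⟩
  · cases t with
    | nil =>
      refine ⟨M₁, by simp, ⟨[], m, by simpa using h2.symm⟩, ?_⟩
      rintro _ ⟨l', m', rfl⟩
      exact ⟨l ++ l', m', by simp [h1]⟩
    | cons b t =>
      rw [List.cons_append, List.cons.injEq] at h2
      obtain ⟨rfl, h2⟩ := h2
      have h2 := List.append_eq_replicate_iff.1 h2.symm
      refine ⟨M₂, by simp, ⟨_, h2.2.2⟩, ?_⟩
      rintro _ ⟨m', rfl⟩
      refine ⟨l, t.length + m', ?_⟩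
      rw [h1, h2.2.1, List.replicate_add, List.length_replicate, List.append_assoc,
        List.cons_append]

/-- Both words are expanded from the same control word and cut into blocks on the fly. The cutting
has finitely many states because fewer than `n` letters wait, and membership in `N` is a regular
condition on the control word. -/
theorem isRegular_appendPower [Finite A] [DecidableEq A] {B : Type*} [Finite B] {n : ℕ}
    (hn : 0 < n) (y : A) (f : List A → B) {N : Set (List A)} (hN : Language.IsRegular N)
    (s p t q : List A) (D : ℕ)
    (hD : ∀ l m,
      (blocks n y ([], false) (appendPower s p l m)).length ≤
        (blocks n y ([], false) (appendPower t q l m)).length + D ∧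
      (blocks n y ([], false) (appendPower t q l m)).length ≤
        (blocks n y ([], false) (appendPower s p l m)).length + D) :
    (padRel {r : List B × List B | ∃ l m, appendPower s p l m ∈ N ∧ appendPower t q l m ∈ N ∧
      r = ((encodeFrom n y ([], false) (appendPower s p l m)).map f,
        (encodeFrom n y ([], false) (appendPower t q l m)).map f)}).IsRegular := by
  let g : List A → List A → A ⊕ Bool → List A := fun s p c =>
    match c with
    | .inl a => [a]
    | .inr false => s
    | .inr true => p
  have hg : ∀ (s p l : List A) (m : ℕ), (l.map Sum.inl ++ Sum.inr false ::
      List.replicate m (Sum.inr true)).flatMap (g s p) = appendPower s p l m := by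
    intro s p l m
    have : (l.map (Sum.inl (β := Bool))).flatMap (g s p) = l := by
      induction l with
      | nil => rfl
      | cons a l ih => simpa [g] using ih
    rw [List.flatMap_append, this, List.flatMap_cons, appendPower, List.append_assoc]
    congr 2
    rw [List.flatMap_def, List.map_replicate]
  have hgl : ∀ (s p l : List A), (l.map Sum.inl).flatMap (g s p) = l := by
    intro s p l
    induction l with
    | nil => rfl
    | cons a l ih => simpa [g] using ih
  let E := D + 1 + s.length + p.length + t.length + q.length
  have hlen : ∀ s p c, (g s p c).length ≤ 1 + s.length + p.length := by
    rintro s p (a | _ | _) <;> simp [g] <;> omega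
  have hstep : ∀ s p c a, ((blocks n y ([], false) ((c ++ [a]).flatMap (g s p))).map f).length ≤
      ((blocks n y ([], false) (c.flatMap (g s p))).map f).length + (1 + s.length + p.length) := by
    intro s p c a
    rw [List.flatMap_append, blocks_append, List.map_append, List.length_append]
    have h1 := hlen s p a
    have h2 := length_blocks_le (n := n) (y := y)
      (finalState n y ([], false) (c.flatMap (g s p))) (g s p a)
    simp only [List.flatMap_cons, List.flatMap_nil, List.append_nil, List.length_map]
    omega
  have key := isRegular_padRel_of_boundedDelay (B := B)
    ((isRegular_moves (A := A)).inf ((isRegular_comap_flatMap (g s p) hN).inf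
      (isRegular_comap_flatMap (g t q) hN)))
    (fun c => (finalState n y ([], false) (c.flatMap (g s p)),
      finalState n y ([], false) (c.flatMap (g t q))))
    (by
      have hfin : {s : List A × Bool | s.1.length < n}.Finite :=
        ((List.finite_length_lt A n).prod Set.finite_univ).subset fun s hs => ⟨hs, trivial⟩
      refine (hfin.prod hfin).subset ?_
      rintro _ ⟨c, rfl⟩
      exact ⟨length_finalState_lt hn (s := ([], false)) hn _,
        length_finalState_lt hn (s := ([], false)) hn _⟩)
    (fun c => (blocks n y ([], false) (c.flatMap (g s p))).map f)
    (fun c => (blocks n y ([], false) (c.flatMap (g t q))).map f)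
    (fun c => (encodeFrom n y ([], false) (c.flatMap (g s p))).map f)
    (fun c => (encodeFrom n y ([], false) (c.flatMap (g t q))).map f)
    (fun σ d => (encodeFrom n y σ.1 (d.flatMap (g s p))).map f)
    (fun σ d => (encodeFrom n y σ.2 (d.flatMap (g t q))).map f)
    E
    (by intro c d; simp only [List.flatMap_append, encodeFrom_append, List.map_append])
    (by intro c d; simp only [List.flatMap_append, encodeFrom_append, List.map_append])
    rfl rfl
    (fun c a => (hstep s p c a).trans (by simp only [E]; omega))
    (fun c a => (hstep t q c a).trans (by simp only [E]; omega))
    (fun c => by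
      have := length_encodeFrom_le (n := n) (y := y) ([], false) (c.flatMap (g s p))
      simp only [E, List.length_map]; omega)
    (fun c => by
      have := length_encodeFrom_le (n := n) (y := y) ([], false) (c.flatMap (g t q))
      simp only [E, List.length_map]; omega)
    -- Before `inr false` is read the two outputs coincide; afterwards `hD` applies with the number
    -- of copies read so far.
    (by
      rintro c d ⟨⟨l, m, h⟩, -⟩
      simp only [List.length_map]
      rw [List.append_eq_append_iff] at h
      rcases h with ⟨v, h1, -⟩ | ⟨v, h1, h2⟩
      · obtain ⟨l₁, l₂, rfl, rfl, rfl⟩ := List.map_eq_append_iff.1 h1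
        simp only [hgl]
        omega
      · cases v with
        | nil =>
          rw [h1, List.append_nil]
          simp only [hgl]
          omega
        | cons b v =>
          rw [List.cons_append, List.cons.injEq] at h2
          obtain ⟨rfl, h2⟩ := h2
          have h2 := List.append_eq_replicate_iff.1 h2.symm
          rw [h1, h2.2.1]
          simp only [hg]
          have := hD l v.length
          simp only [E]
          omega)
  refine (congrArg (fun U => (padRel U).IsRegular) (Set.ext fun r => ?_)).mp key
  constructor
  · rintro ⟨_, ⟨⟨l, m, rfl⟩, h1, h2⟩, rfl⟩
    refine ⟨l, m, ?_⟩
    have h1 : List.flatMap _ _ ∈ N := h1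
    have h2 : List.flatMap _ _ ∈ N := h2
    rw [hg] at h1 h2
    exact ⟨h1, h2, by simp only [hg]⟩
  · rintro ⟨l, m, h1, h2, rfl⟩
    refine ⟨_, ⟨⟨l, m, rfl⟩, ?_, ?_⟩, ?_⟩
    · show _ ∈ N
      rwa [hg]
    · show _ ∈ N
      rwa [hg]
    · simp only [hg]

end Relations

/-! ### Rewriting with a single rule -/

section Rewriting

variable {A : Type*}

/-- One application of the rule `w → v`. -/
def RewStep (w v s t : List A) : Prop := ∃ a b, s = a ++ w ++ b ∧ t = a ++ v ++ b

/-- Equality of words modulo the relation `w = v`. -/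
abbrev RewEqv (w v : List A) : List A → List A → Prop := Relation.EqvGen (RewStep w v)

theorem RewStep.context {w v s t : List A} (h : RewStep w v s t) (c d : List A) :
    RewStep w v (c ++ s ++ d) (c ++ t ++ d) := by
  obtain ⟨a, b, rfl, rfl⟩ := h
  exact ⟨c ++ a, b ++ d, by simp, by simp⟩

theorem eqvGen_map {α β : Type*} {r : α → α → Prop} {r' : β → β → Prop} (f : α → β)
    (h : ∀ s t, r s t → r' (f s) (f t)) {s t : α} (hst : Relation.EqvGen r s t) :
    Relation.EqvGen r' (f s) (f t) := by
  induction hst with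
  | rel _ _ hst => exact .rel _ _ (h _ _ hst)
  | refl => exact .refl _
  | symm _ _ _ ih => exact .symm _ _ ih
  | trans _ _ _ _ _ ih₁ ih₂ => exact .trans _ _ _ ih₁ ih₂

theorem eqvGen_imp_eq {α β : Type*} {r : α → α → Prop} (f : α → β)
    (h : ∀ s t, r s t → f s = f t) {s t : α} (hst : Relation.EqvGen r s t) : f s = f t := by
  induction hst with
  | rel _ _ hst => exact h _ _ hst
  | refl => rfl
  | symm _ _ _ ih => exact ih.symm
  | trans _ _ _ _ _ ih₁ ih₂ => exact ih₁.trans ih₂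

theorem RewEqv.context {w v s t : List A} (h : RewEqv w v s t) (c d : List A) :
    RewEqv w v (c ++ s ++ d) (c ++ t ++ d) :=
  eqvGen_map (fun s => c ++ s ++ d) (fun _ _ h => h.context c d) h

theorem lex_append_append {r : A → A → Prop} {s t : List A} (h : List.Lex r s t)
    (hl : s.length = t.length) (d : List A) : List.Lex r (s ++ d) (t ++ d) := by
  induction h with
  | nil => simp at hl
  | cons _ ih => exact .cons (ih (by simpa using hl))
  | rel h => exact .rel h

variable [LinearOrder A]

/-- The degree-lexicographic order on lists. -/
abbrev DegLexLT (s t : List A) : Prop := List.Shortlex (fun a b : A => a < b) s t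

theorem DegLexLT.context {s t : List A} (h : DegLexLT s t) (c d : List A) :
    DegLexLT (c ++ s ++ d) (c ++ t ++ d) := by
  rw [List.append_assoc, List.append_assoc]
  refine List.Shortlex.append_left ?_ c
  rcases List.shortlex_def.1 h with h | ⟨h, h'⟩
  · exact .of_length_lt (by simpa using h)
  · exact .of_lex (by simpa using h) (lex_append_append h' h d)

theorem RewStep.lt {w v s t : List A} (hvw : DegLexLT v w) (h : RewStep w v s t) :
    DegLexLT t s := by
  obtain ⟨a, b, rfl, rfl⟩ := h
  exact hvw.context a b

/-- One application of the rule `w → v` to a word below `W`. -/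
def RewStepBelow (w v W s t : List A) : Prop := RewStep w v s t ∧ DegLexLT s W

theorem eqvGen_below_context {w v W s t : List A} (h : Relation.EqvGen (RewStepBelow w v W) s t)
    (c d : List A) :
    Relation.EqvGen (RewStepBelow w v (c ++ W ++ d)) (c ++ s ++ d) (c ++ t ++ d) :=
  eqvGen_map (fun s => c ++ s ++ d) (fun _ _ h => ⟨h.1.context c d, h.2.context c d⟩) h

/-- Every overlap of `w` with itself is resolved by words below it. -/
def OverlapsResolve (w v : List A) : Prop := ∀ a b, w ++ b = a ++ w →
  (w ++ b).length < w.length + w.length →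
  Relation.EqvGen (RewStepBelow w v (w ++ b)) (v ++ b) (a ++ v)

/-- Here `c` is the shift from the left occurrence of `w` to the right one. Disjoint occurrences can
both be rewritten, giving a common word; overlapping ones are a resolved overlap placed in a
context. -/
theorem eqvGen_below_of_le {w v : List A} (hvw : DegLexLT v w) (hR : OverlapsResolve w v)
    {a b c b' : List A} (h : a ++ w ++ b = a ++ c ++ w ++ b') :
    Relation.EqvGen (RewStepBelow w v (a ++ w ++ b)) (a ++ v ++ b) (a ++ c ++ v ++ b') := by
  have h' : w ++ b = c ++ w ++ b' := by simpa using h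
  rw [List.append_assoc, List.append_eq_append_iff] at h'
  have hcases : (∃ d, c = w ++ d ∧ b = d ++ (w ++ b')) ∨ ∃ e f, e ≠ [] ∧ w = c ++ e ∧
      w = e ++ f ∧ b = f ++ b' := by
    rcases h' with h' | ⟨e, hw, hb⟩
    · exact .inl h'
    · rcases eq_or_ne e [] with rfl | he
      · exact .inl ⟨[], by simpa using hw.symm, by simpa using hb.symm⟩
      · rw [List.append_eq_append_iff] at hb
        rcases hb with ⟨f, h1, h2⟩ | ⟨f, h1, h2⟩
        · have h3 := congrArg List.length hw
          have h4 := congrArg List.length h1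
          rw [List.length_append] at h3 h4
          obtain rfl : f = [] := List.length_eq_zero_iff.1 (by omega)
          exact .inr ⟨e, [], he, hw, by simpa using h1.symm, by simpa using h2.symm⟩
        · exact .inr ⟨e, f, he, hw, h1, h2⟩
  rcases hcases with ⟨d, rfl, rfl⟩ | ⟨e, f, he, hw, hf, rfl⟩
  · have h₁ : RewStep w v (a ++ v ++ (d ++ (w ++ b'))) (a ++ v ++ d ++ v ++ b') :=
      ⟨a ++ v ++ d, b', by simp, by simp⟩
    have h₂ : RewStep w v (a ++ (w ++ d) ++ v ++ b') (a ++ v ++ d ++ v ++ b') :=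
      ⟨a, d ++ v ++ b', by simp, by simp⟩
    refine .trans _ _ _ (.rel _ _ ⟨h₁, hvw.context _ _⟩) (.symm _ _ (.rel _ _ ⟨h₂, ?_⟩))
    have := hvw.context (a ++ w ++ d) b'
    simpa using this
  · have hov : w ++ f = c ++ w := by
      conv_lhs => rw [hw]
      conv_rhs => rw [hf]
      simp
    have hlen : (w ++ f).length < w.length + w.length := by
      have h1 := congrArg List.length hf
      have h2 := List.length_pos_iff.2 he
      rw [List.length_append] at h1 ⊢
      omega
    simpa using eqvGen_below_context (hR c f hov hlen) a b'

theorem eqvGen_below_of_steps {w v : List A} (hvw : DegLexLT v w) (hR : OverlapsResolve w v)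
    {W s t : List A} (hs : RewStep w v W s) (ht : RewStep w v W t) :
    Relation.EqvGen (RewStepBelow w v W) s t := by
  obtain ⟨a, b, rfl, rfl⟩ := hs
  obtain ⟨a', b', h, rfl⟩ := ht
  have h' := h
  rw [List.append_assoc, List.append_assoc, List.append_eq_append_iff] at h'
  rcases h' with ⟨c, rfl, -⟩ | ⟨c, rfl, -⟩
  · exact eqvGen_below_of_le hvw hR h
  · rw [h]
    exact .symm _ _ (eqvGen_below_of_le hvw hR h.symm)

/-- A terminating rule all of whose overlaps resolve has unique normal forms. -/
theorem exists_normalForm [Finite A] {w v : List A} (hvw : DegLexLT v w)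
    (hR : OverlapsResolve w v) :
    ∃ nf : List A → List A, (∀ s, ¬ w <:+: nf s) ∧ (∀ s, RewEqv w v s (nf s)) ∧
      (∀ s t, RewEqv w v s t → nf s = nf t) ∧ ∀ s, ¬ w <:+: s → nf s = s := by
  have hwf : WellFounded (fun s t : List A => DegLexLT s t) := List.Shortlex.wf wellFounded_lt
  have hex : ∀ s : List A, ∃ t, ¬ w <:+: t ∧ Relation.ReflTransGen (RewStep w v) s t := by
    intro s
    induction s using hwf.induction with
    | _ s ih =>
      by_cases h : w <:+: s
      · obtain ⟨a, b, rfl⟩ := h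
        have hstep : RewStep w v (a ++ w ++ b) (a ++ v ++ b) := ⟨a, b, rfl, rfl⟩
        obtain ⟨t, ht, hst⟩ := ih _ (hstep.lt hvw)
        exact ⟨t, ht, .head hstep hst⟩
      · exact ⟨s, h, .refl⟩
  choose nf hirr hred using hex
  have hfix : ∀ s, ¬ w <:+: s → nf s = s := by
    intro s hs
    rcases (hred s).cases_head with h | ⟨t, ⟨a, b, rfl, -⟩, -⟩
    · exact h.symm
    · exact absurd ⟨a, b, rfl⟩ hs
  -- Well-founded induction on `W`: `nf` is constant along steps between words below `W`, and any
  -- two one-step reducts of `W` are connected by such steps.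
  have huniq : ∀ W z, ¬ w <:+: z → Relation.ReflTransGen (RewStep w v) W z → nf W = z := by
    intro W
    induction W using hwf.induction with
    | _ W ih =>
      intro z hz hWz
      have hbelow : ∀ s t, RewStepBelow w v W s t → nf s = nf t := fun s t h =>
        ih s h.2 _ (hirr t) (.head h.1 (hred t))
      rcases hWz.cases_head with rfl | ⟨t, ht, htz⟩
      · exact hfix _ hz
      rcases (hred W).cases_head with h | ⟨t', ht', htn⟩
      · obtain ⟨a, b, hW, -⟩ := ht
        have h' := hirr W
        rw [← h] at h'
        exact absurd ⟨a, b, hW.symm⟩ h'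
      · rw [← ih t (ht.lt hvw) z hz htz, ← ih t' (ht'.lt hvw) _ (hirr W) htn]
        exact eqvGen_imp_eq nf hbelow (eqvGen_below_of_steps hvw hR ht' ht)
  exact ⟨nf, hirr, fun s => Relation.EqvGen.reflTransGen_le_eqvGen _ _ _ (hred s),
    fun s t h => eqvGen_imp_eq nf (fun s t h => huniq s _ (hirr t) (.head h (hred t))) h, hfix⟩

end Rewriting

/-! ### Gröbner–Shirshov bases of one binomial -/

section Groebner

variable {F : Type v} [Field F] {A : Type u}

open Classical in
theorem coeff_mon (s t : FreeMonoid A) : (mon F s).coeff t = if s = t then 1 else 0 := by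
  simp [mon, MonoidAlgebra.of_apply, Finsupp.single_apply]

variable [LinearOrder A]

theorem isLeadingWord_binomial {w v : FreeMonoid A} (hvw : degLex v w) :
    IsLeadingWord (mon F w - mon F v) w := by
  have hne : v ≠ w := by
    rintro rfl
    exact Std.Irrefl.irrefl (r := List.Shortlex fun a b : A => a < b) _ hvw
  refine ⟨by simp [coeff_mon, hne], fun t ht hne' => ?_⟩
  by_cases h : v = t
  · exact h ▸ hvw
  · simp [coeff_mon, h, hne'.symm] at ht

theorem IsLeadingWord.unique {f : FreeAlg F A} {s t : FreeMonoid A} (hs : IsLeadingWord f s)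
    (ht : IsLeadingWord f t) : s = t := by
  by_contra hne
  exact Std.Asymm.asymm (r := List.Shortlex fun a b : A => a < b) _ _
    (hs.2 t ht.1 (Ne.symm hne)) (ht.2 s hs.1 hne)

/-- Linear algebra becomes rewriting through the functional `χ`, the indicator of the class of `v ++
b` under steps below `w ++ b`. It kills every generator allowed in a trivial composition, whose two
monomials lie in one class, hence kills the composition, which is the difference of `a ++ v` and `v
++ b`. -/
theorem overlapsResolve_of_groebner {w v : List A}
    (hvw : DegLexLT v w) (hGS : IsGroebnerShirshov
      ({mon F (FreeMonoid.ofList w) - mon F (FreeMonoid.ofList v)} : Set (FreeAlg F A))) :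
    OverlapsResolve w v := by
  classical
  intro a b hab hlen
  have hlead : IsLeadingWord (mon F (FreeMonoid.ofList w) - mon F (FreeMonoid.ofList v))
    (FreeMonoid.ofList w) := isLeadingWord_binomial hvw
  have htriv := hGS.intersection _ rfl _ rfl _ _ (FreeMonoid.ofList a) (FreeMonoid.ofList b)
    hlead hlead (congrArg FreeMonoid.ofList hab) hlen
  let χ : FreeAlg F A →ₗ[F] F := (Finsupp.linearCombination F fun s : FreeMonoid A =>
      if Relation.EqvGen (RewStepBelow w v (w ++ b)) (v ++ b) s.toList then (1 : F) else 0) ∘ₗ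
    (MonoidAlgebra.coeffLinearEquiv F).toLinearMap
  have hχ : ∀ s : FreeMonoid A, χ (mon F s) =
      if Relation.EqvGen (RewStepBelow w v (w ++ b)) (v ++ b) s.toList then (1 : F) else 0 := by
    intro s
    simp [χ, mon, MonoidAlgebra.of_apply, MonoidAlgebra.coeffLinearEquiv]
  have hmul : ∀ c s d : FreeMonoid A, mon F c * mon F s * mon F d = mon F (c * s * d) := by
    intro c s d
    simp [mon]
  have hker : ∀ h, IsTrivialMod {mon F (FreeMonoid.ofList w) - mon F (FreeMonoid.ofList v)}
      (FreeMonoid.ofList w * FreeMonoid.ofList b) h → χ h = 0 := by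
    intro h hh
    refine (Submodule.span_le (p := LinearMap.ker χ)).2 ?_ hh
    rintro _ ⟨_, rfl, m, c, d, hm, hlt, rfl⟩
    rw [hm.unique hlead] at hlt
    rw [SetLike.mem_coe, LinearMap.mem_ker, mul_sub, sub_mul, map_sub, hmul, hmul, hχ, hχ]
    have hstep : RewStepBelow w v (w ++ b) (c.toList ++ w ++ d.toList) (c.toList ++ v ++ d.toList) :=
      ⟨⟨_, _, rfl, rfl⟩, hlt⟩
    refine sub_eq_zero.2 (if_congr ⟨fun h => ?_, fun h => ?_⟩ rfl rfl)
    · exact .trans _ _ _ h (.rel _ _ hstep)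
    · exact .trans _ _ _ h (.symm _ _ (.rel _ _ hstep))
  have h0 := hker _ htriv
  have hmul₁ : ∀ s t : FreeMonoid A, mon F s * mon F t = mon F (s * t) := by
    intro s t
    simp [mon]
  have hab' : FreeMonoid.ofList w * FreeMonoid.ofList b = FreeMonoid.ofList a * FreeMonoid.ofList w :=
    congrArg FreeMonoid.ofList hab
  rw [sub_mul, mul_sub, hmul₁, hmul₁, hmul₁, hmul₁, hab', sub_sub_sub_cancel_left, map_sub, hχ, hχ]
    at h0
  by_contra hcon
  have h1 : Relation.EqvGen (RewStepBelow w v (w ++ b)) (v ++ b)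
    (FreeMonoid.ofList v * FreeMonoid.ofList b).toList := .refl _
  have h2 : ¬ Relation.EqvGen (RewStepBelow w v (w ++ b)) (v ++ b)
    (FreeMonoid.ofList a * FreeMonoid.ofList v).toList := hcon
  rw [if_pos h1, if_neg h2] at h0
  simp at h0

end Groebner

/-! ### Right multiplication of normal forms by a letter -/

section Normal

variable {A : Type*} {u : List A} {l x y : A}

theorem suffix_concat_concat {s : List A} {a : A} : u ++ [l] <:+ s ++ [a] ↔ u <:+ s ∧ l = a := by
  rw [List.suffix_append_inj_of_length_eq (s₁ := [l]) (s₂ := [a]) rfl]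
  simp

theorem not_infix_concat {s : List A} (hs : ¬ u ++ [l] <:+: s) {a : A}
    (h : ¬ (u <:+ s ∧ l = a)) : ¬ u ++ [l] <:+: s ++ [a] := by
  rw [List.infix_concat_iff, suffix_concat_concat]
  exact not_or.2 ⟨h, hs⟩

/-- An occurrence created by the final `y` would have at least two letters and therefore end in
`xy`. -/
theorem not_infix_concat_pair (hu : u ≠ []) (hxy : ¬ [x, y] <:+ u ++ [l]) {s : List A}
    (hs : ¬ u ++ [l] <:+: s ++ [x]) : ¬ u ++ [l] <:+: s ++ [x] ++ [y] := by
  refine not_infix_concat hs ?_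
  rintro ⟨h, rfl⟩
  rcases List.suffix_concat_iff.1 h with h | ⟨t, rfl, -⟩
  · exact hu h
  · exact hxy ⟨t, by simp⟩

theorem not_infix_append_replicate (hu : u ≠ []) (hxy : ¬ [l, y] <:+ u ++ [l]) {s : List A}
    (hs : ¬ u ++ [l] <:+: s ++ [l]) (m : ℕ) :
    ¬ u ++ [l] <:+: s ++ [l] ++ List.replicate m y := by
  by_cases hl : l = y
  · subst hl
    induction m generalizing s with
    | zero => simpa using hs
    | succ m ih =>
      have := ih (not_infix_concat_pair hu hxy hs)
      rw [List.replicate_succ]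
      simpa using this
  · induction m with
    | zero => simpa using hs
    | succ m ih =>
      rw [List.replicate_succ', ← List.append_assoc]
      exact not_infix_concat ih fun h => hl h.2

/-- Copies of `u` are stripped from the end as long as appending `l` creates an occurrence; since
`s` avoids `u ++ [l]`, such an occurrence must be at the very end. -/
theorem exists_eq_append_power (hu : u ≠ []) (s : List A) (hs : ¬ u ++ [l] <:+: s) :
    ∃ t m, s = t ++ (List.replicate m u).flatten ∧ ¬ u ++ [l] <:+: t ++ [l] := by
  induction hk : s.length using Nat.strong_induction_on generalizing s with
  | _ k ih =>
    by_cases h : u ++ [l] <:+: s ++ [l]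
    · rw [List.infix_concat_iff, suffix_concat_concat] at h
      obtain ⟨⟨r, rfl⟩, -⟩ := h.resolve_right hs
      obtain ⟨t, m, rfl, ht⟩ := ih r.length
        (by rw [← hk, List.length_append]; have := List.length_pos_iff.2 hu; omega) r
        (fun h => hs (h.trans ⟨[], u, by simp⟩)) rfl
      exact ⟨t, m + 1, by rw [List.replicate_succ']; simp, ht⟩
    · exact ⟨s, 0, by simp, h⟩

/-- The cascade for `l = x`: rewriting the last `u l` to `l y` hands `l` on to the preceding copy of
`u` and leaves one `y` behind. -/
theorem rewEqv_append_power (s : List A) (m : ℕ) :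
    RewEqv (u ++ [l]) [l, y] (s ++ (List.replicate m u).flatten ++ [l])
      (s ++ [l] ++ List.replicate m y) := by
  induction m with
  | zero => simpa using Relation.EqvGen.refl _
  | succ m ih =>
    have h₁ : RewStep (u ++ [l]) [l, y] (s ++ (List.replicate (m + 1) u).flatten ++ [l])
        (s ++ (List.replicate m u).flatten ++ [l] ++ [y]) :=
      ⟨s ++ (List.replicate m u).flatten, [], by rw [List.replicate_succ']; simp, by simp⟩
    have h₂ := ih.context [] [y]
    rw [List.nil_append, List.nil_append, List.append_assoc (s ++ [l]),
      ← List.replicate_succ'] at h₂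
    exact .trans _ _ _ (.rel _ _ h₁) h₂

theorem RewEqv.eq_nil_iff {w v s t : List A} (hw : w ≠ []) (hv : v ≠ []) (h : RewEqv w v s t) :
    s = [] ↔ t = [] := by
  refine Eq.to_iff (eqvGen_imp_eq (fun s : List A => s = []) ?_ h)
  rintro _ _ ⟨a, b, rfl, rfl⟩
  simp [hw, hv]

end Normal

/-! ### The encoded multiplication relations -/

/-- The nonempty words that avoid `w`. -/
def normalWords {A : Type*} (w : List A) : Set (List A) := {s | s ≠ [] ∧ ¬ w <:+: s}

theorem isRegular_infix {A : Type*} (w : List A) : Language.IsRegular {s : List A | w <:+: s} := by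
  let K : List A → Language A := fun w' => {z : List A | w' <+: z}
  let K₀ : Language A := {z : List A | w <:+: z}
  let K₁ : Language A := Set.univ
  refine isRegular_of_finite_cover (K '' {t | t <:+ w} ∪ {K₀, K₁})
    ((((List.finite_toSet w.tails).subset (by intro t ht; simpa using ht)).image _).union
      (by simp)) ?_
  rintro v z ⟨a, b, h⟩
  rw [List.append_assoc, List.append_eq_append_iff] at h
  rcases h with ⟨c, rfl, h⟩ | ⟨c, rfl, h⟩
  · rw [List.append_eq_append_iff] at h
    rcases h with ⟨d, rfl, -⟩ | ⟨d, rfl, rfl⟩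
    · refine ⟨K₁, by simp, trivial, fun z' _ => ⟨a, d ++ z', by simp⟩⟩
    · refine ⟨K d, .inl ⟨d, ⟨c, rfl⟩, rfl⟩, ⟨b, rfl⟩, ?_⟩
      rintro _ ⟨e, rfl⟩
      exact ⟨a, e, by simp⟩
  · refine ⟨K₀, by simp, ⟨c, b, by rw [h]; simp⟩, ?_⟩
    rintro _ ⟨e, f, rfl⟩
    exact ⟨v ++ e, f, by simp⟩

theorem isRegular_normalWords {A : Type*} (w : List A) :
    Language.IsRegular (normalWords w) :=
  (isRegular_singleton ([] : List A)).compl.inf (isRegular_infix w).compl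

section Multiplication

variable {A B : Type*} [DecidableEq A]

/-- The encoding of a word by blocks of `n` letters, with a given alphabet of blocks. -/
def encode (n : ℕ) (y : A) (f : List A → B) (s : List A) : List B :=
  (encodeFrom n y ([], false) s).map f

/-- The encoded pairs of normal forms `(s, t)` with `s v = t`. -/
def mulRel (n : ℕ) (y : A) (f : List A → B) (w r v : List A) : Set (List B × List B) :=
  {p | ∃ s ∈ normalWords w, ∃ t ∈ normalWords w, RewEqv w r (s ++ v) t ∧
    p = (encode n y f s, encode n y f t)}

variable [Finite A] [Finite B] {n : ℕ} {y : A} {f : List A → B}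

theorem isRegular_append_pair (hn : 0 < n) {N : Set (List A)} (hN : Language.IsRegular N)
    (s t : List A) :
    (padRel {r : List B × List B | ∃ l, l ++ s ∈ N ∧ l ++ t ∈ N ∧
      r = (encode n y f (l ++ s), encode n y f (l ++ t))}).IsRegular := by
  have h := isRegular_appendPower hn y f hN s [] t [] (s.length + t.length) (by
    intro l m
    have h₁ := length_blocks_le (n := n) (y := y) (finalState n y ([], false) l) s
    have h₂ := length_blocks_le (n := n) (y := y) (finalState n y ([], false) l) t
    simp only [appendPower, List.flatten_replicate_nil, List.append_nil, blocks_append,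
      List.length_append]
    omega)
  simpa [appendPower, encode] using h

theorem isRegular_append_powers (hn : 0 < n) {N : Set (List A)} (hN : Language.IsRegular N)
    {u : List A} (hu : u.length = n) (hne : u ≠ List.replicate n y) (x : A) :
    (padRel {r : List B × List B | ∃ (l : List A) (m : ℕ),
      l ++ (List.replicate m u).flatten ∈ N ∧ l ++ [x] ++ List.replicate m y ∈ N ∧
      r = (encode n y f (l ++ (List.replicate m u).flatten),
        encode n y f (l ++ [x] ++ List.replicate m y))}).IsRegular := by
  have h := isRegular_appendPower hn y f hN [] u [x] [y] (3 * n + 2) (by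
    intro l m
    simp only [appendPower, List.append_nil, List.flatten_replicate_singleton]
    exact length_blocks_power_le hn hu hne x l m)
  simpa only [appendPower, encode, List.append_nil, List.flatten_replicate_singleton] using h

variable {u : List A} {l x : A} {nf : List A → List A}

/-- For `a = l = x` the pairs are `(t uᵐ, t x yᵐ)`, the only case that needs `hpow` and the special
blocks. In the other cases the two words differ only in a tail of bounded length. -/
theorem isRegular_mulRel_singleton (hn : 0 < n) (hu : u.length = n)
    (hxy : ¬ [x, y] <:+ u ++ [l]) (hpow : l = x → u ≠ List.replicate n y)
    (huniq : ∀ s t, ¬ u ++ [l] <:+: s → ¬ u ++ [l] <:+: t → RewEqv (u ++ [l]) [x, y] s t → s = t)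
    (a : A) : (padRel (mulRel n y f (u ++ [l]) [x, y] [a])).IsRegular := by
  have hu0 : u ≠ [] := List.length_pos_iff.1 (hu ▸ hn)
  have hN := isRegular_normalWords (u ++ [l])
  have hprefix : ∀ {s t : List A}, ¬ u ++ [l] <:+: s ++ t → ¬ u ++ [l] <:+: s := fun h h' =>
    h (h'.trans (List.prefix_append _ _).isInfix)
  by_cases hal : a = l
  · subst hal
    by_cases hlx : a = x
    · subst hlx
      refine (congrArg (fun U => (padRel U).IsRegular) (Set.ext fun r => ?_)).mp
        (isRegular_append_powers (f := f) hn hN hu (hpow rfl) a)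
      constructor
      · rintro ⟨s, m, h₁, h₂, rfl⟩
        exact ⟨_, h₁, _, h₂, rewEqv_append_power s m, rfl⟩
      · rintro ⟨s, hs, t, ht, hst, rfl⟩
        obtain ⟨s', m, rfl, hs'⟩ := exists_eq_append_power hu0 s hs.2
        have h := not_infix_append_replicate hu0 hxy hs' m
        obtain rfl := huniq _ _ ht.2 h (.trans _ _ _ (.symm _ _ hst) (rewEqv_append_power s' m))
        exact ⟨s', m, hs, ht, rfl⟩
    · refine (congrArg (fun U => (padRel U).IsRegular) (Set.ext fun r => ?_)).mp
        (isRegular_padRel_union (isRegular_append_pair (f := f) (y := y) hn hN [] [a])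
          (isRegular_append_pair (f := f) (y := y) hn hN u [x, y]))
      have hred : ∀ s, RewEqv (u ++ [a]) [x, y] (s ++ u ++ [a]) (s ++ [x, y]) := fun s =>
        .rel _ _ ⟨s, [], by simp, by simp⟩
      constructor
      · rintro (⟨s, h₁, h₂, rfl⟩ | ⟨s, h₁, h₂, rfl⟩)
        · exact ⟨_, h₁, _, h₂, by simpa using Relation.EqvGen.refl _, rfl⟩
        · exact ⟨_, h₁, _, h₂, hred s, rfl⟩
      · rintro ⟨s, hs, t, ht, hst, rfl⟩
        by_cases h : u ++ [a] <:+: s ++ [a]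
        · rw [List.infix_concat_iff, suffix_concat_concat] at h
          obtain ⟨⟨s', rfl⟩, -⟩ := h.resolve_right hs.2
          have h' : ¬ u ++ [a] <:+: s' ++ [x, y] := by
            have := not_infix_concat_pair hu0 hxy
              (not_infix_concat (hprefix hs.2) (a := x) fun h => hlx h.2)
            simpa using this
          obtain rfl := huniq _ _ ht.2 h' (.trans _ _ _ (.symm _ _ hst) (hred s'))
          exact .inr ⟨s', hs, ht, rfl⟩
        · obtain rfl := huniq _ _ h ht.2 hst
          exact .inl ⟨s, by simpa using hs, ht, by simp⟩
  · refine (congrArg (fun U => (padRel U).IsRegular) (Set.ext fun r => ?_)).mp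
      (isRegular_append_pair (f := f) (y := y) hn hN [] [a])
    constructor
    · rintro ⟨s, h₁, h₂, rfl⟩
      exact ⟨_, h₁, _, h₂, by simpa using Relation.EqvGen.refl _, rfl⟩
    · rintro ⟨s, hs, t, ht, hst, rfl⟩
      have h : ¬ u ++ [l] <:+: s ++ [a] := not_infix_concat hs.2 fun h => hal h.2.symm
      obtain rfl := huniq _ _ h ht.2 hst
      exact ⟨s, by simpa using hs, ht, by simp⟩

/-- The generators of the structure are blocks, so multiplication by whole words is needed. It is
composed from letters through the normal form of `s ++ v`; `henc` ensures that the intermediate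
encoding determines the intermediate word. -/
theorem isRegular_mulRel (hn : 0 < n) (hu : u.length = n)
    (hxy : ¬ [x, y] <:+ u ++ [l]) (hpow : l = x → u ≠ List.replicate n y)
    (hnf : ∀ s, ¬ u ++ [l] <:+: nf s) (hnf' : ∀ s, RewEqv (u ++ [l]) [x, y] s (nf s))
    (huniq : ∀ s t, ¬ u ++ [l] <:+: s → ¬ u ++ [l] <:+: t → RewEqv (u ++ [l]) [x, y] s t → s = t)
    (henc : ∀ s ∈ normalWords (u ++ [l]), ∀ t ∈ normalWords (u ++ [l]),
      encode n y f s = encode n y f t → s = t)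
    (v : List A) : (padRel (mulRel n y f (u ++ [l]) [x, y] v)).IsRegular := by
  induction v using List.reverseRecOn with
  | nil =>
    refine (congrArg (fun U => (padRel U).IsRegular) (Set.ext fun r => ?_)).mp
      (isRegular_append_pair (f := f) (y := y) hn (isRegular_normalWords (u ++ [l])) [] [])
    constructor
    · rintro ⟨s, h₁, h₂, rfl⟩
      exact ⟨_, h₁, _, h₂, by simpa using Relation.EqvGen.refl _, rfl⟩
    · rintro ⟨s, hs, t, ht, hst, rfl⟩
      obtain rfl := huniq _ _ hs.2 ht.2 (by simpa using hst)
      exact ⟨s, by simpa using hs, by simpa using hs, by simp⟩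
  | append_singleton v a ih =>
    refine (congrArg (fun U => (padRel U).IsRegular) (Set.ext fun r => ?_)).mp
      (isRegular_padRel_comp ih (isRegular_mulRel_singleton (f := f) hn hu hxy hpow huniq a))
    obtain ⟨r₁, r₂⟩ := r
    constructor
    · rintro ⟨_, ⟨s, hs, t, ht, hst, h⟩, t', ht', r, hr, htr, h'⟩
      rw [Prod.mk.injEq] at h h'
      obtain ⟨rfl, rfl⟩ := h
      obtain ⟨h', rfl⟩ := h'
      obtain rfl := henc _ ht _ ht' h'
      refine ⟨s, hs, r, hr, .trans _ _ _ ?_ htr, rfl⟩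
      simpa using hst.context [] [a]
    · rintro ⟨s, hs, r, hr, hsr, h⟩
      rw [Prod.mk.injEq] at h
      obtain ⟨rfl, rfl⟩ := h
      have hne : nf (s ++ v) ≠ [] := by
        have := (hnf' (s ++ v)).eq_nil_iff (by simp) (by simp)
        rw [ne_eq, ← this]
        simp [hs.1]
      refine ⟨_, ⟨s, hs, nf (s ++ v), ⟨hne, hnf _⟩, hnf' _, rfl⟩,
        ⟨_, ⟨hne, hnf _⟩, r, hr, ?_, rfl⟩⟩
      refine .trans _ _ _ (.symm _ _ ?_) hsr
      simpa using (hnf' (s ++ v)).context [] [a]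

end Multiplication

/-! ### Adjoining an identity -/

section Letters

variable {B C : Type*}

theorem letters_mul (p q : FreeSemigroup B) : letters (p * q) = letters p ++ letters q := rfl

theorem letters_injective : Function.Injective (letters : FreeSemigroup B → List B) := by
  rintro ⟨a, s⟩ ⟨b, t⟩ h
  simp only [letters, List.cons.injEq] at h
  exact FreeSemigroup.ext h.1 h.2

theorem exists_letters_eq {s : List B} (hs : s ≠ []) : ∃ p : FreeSemigroup B, letters p = s := by
  obtain ⟨b, t, rfl⟩ := List.exists_cons_of_ne_nil hs
  exact ⟨⟨b, t⟩, rfl⟩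

theorem letters_map (f : B → C) (p : FreeSemigroup B) :
    letters (FreeSemigroup.map f p) = (letters p).map f := by
  induction p with
  | ih1 b => rfl
  | ih2 b p h₁ h₂ => rw [map_mul, letters_mul, letters_mul, h₁, h₂, List.map_append]

theorem padLang_eq_padRel (U : Set (FreeSemigroup B × FreeSemigroup B)) :
    padLang U = padRel ((fun p => (letters p.1, letters p.2)) '' U) :=
  (Set.image_image (fun p : List B × List B => padRight p.1 p.2)
    (fun p : FreeSemigroup B × FreeSemigroup B => (letters p.1, letters p.2)) U).symm

theorem isRegular_padLang_map (f : B → C) {U : Set (FreeSemigroup B × FreeSemigroup B)}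
    (hU : (padLang U).IsRegular) (p q : FreeSemigroup C) :
    (padLang (insert (p, q)
      ((fun p => (FreeSemigroup.map f p.1, FreeSemigroup.map f p.2)) '' U))).IsRegular := by
  rw [padLang_eq_padRel] at hU ⊢
  rw [Set.image_insert_eq]
  refine isRegular_padRel_union (isRegular_padRel_singleton _ _) ?_
  convert isRegular_padRel_map f hU using 2
  simp only [Set.image_image, letters_map]

end Letters

/-- A semigroup with a prefix-closed language of unique normal forms yields a prefix-automatic
monoid when an identity is adjoined. -/
theorem isPrefixAutomatic_withOne {S B : Type u} [Semigroup S] [Finite B]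
    {φ : FreeSemigroup B →ₙ* S} {L : Set (FreeSemigroup B)} (h : IsAutomaticStructure φ L)
    (hpref : pref L ⊆ L) (hinj : L.InjOn φ) : IsPrefixAutomatic (WithOne S) := by
  let ψ : FreeSemigroup (Option B) →ₙ* WithOne S :=
    FreeSemigroup.lift fun b => b.elim 1 fun b => (φ (FreeSemigroup.of b) : WithOne S)
  let ι : FreeSemigroup B →ₙ* FreeSemigroup (Option B) := FreeSemigroup.map some
  let e : FreeSemigroup (Option B) := FreeSemigroup.of none
  let L' : Set (FreeSemigroup (Option B)) := insert e (ι '' L)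
  have hψe : ψ e = 1 := by simp [ψ, e]
  have hψι : ∀ p, ψ (ι p) = φ p := by
    intro p
    induction p with
    | ih1 b => simp [ψ, ι]
    | ih2 b p h₁ h₂ => rw [map_mul, map_mul, h₁, h₂, map_mul, WithOne.coe_mul]
  -- With `L'` prefix-closed, the language in the prefix condition is the one already treated in
  -- `heq`.
  have hpref' : pref L' = L' := by
    refine Set.Subset.antisymm ?_ fun p hp => ⟨p, hp, List.prefix_rfl⟩
    rintro p ⟨_, rfl | ⟨q, hq, rfl⟩, hp⟩
    · left
      apply letters_injective
      exact hp.eq_of_length_le (by simp [letters, e])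
    · right
      simp only [ι, letters_map] at hp
      obtain ⟨r, hr⟩ := hp
      obtain ⟨s, t, hst, hs, -⟩ := List.map_eq_append_iff.1 hr.symm
      have hs0 : s ≠ [] := by
        rintro rfl
        simp [letters] at hs
      obtain ⟨p', rfl⟩ := exists_letters_eq hs0
      refine ⟨p', hpref ⟨q, hq, ⟨t, hst.symm⟩⟩, letters_injective ?_⟩
      rw [← hs]
      exact letters_map _ _
  have heq : (padLang {p | p.1 ∈ L' ∧ p.2 ∈ L' ∧ ψ p.1 = ψ p.2}).IsRegular := by
    convert isRegular_padLang_map some h.regular_eq e e using 2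
    ext ⟨p, q⟩
    constructor
    · rintro ⟨rfl | ⟨p, hp, rfl⟩, rfl | ⟨q, hq, rfl⟩, hpq⟩
      · exact .inl rfl
      · simp [hψe, hψι] at hpq
      · simp [hψe, hψι] at hpq
      · exact .inr ⟨(p, q), ⟨hp, hq, by simpa [hψι] using hpq⟩, rfl⟩
    · rintro (hpq | ⟨⟨p, q⟩, ⟨hp, hq, hpq⟩, hpq'⟩)
      · obtain ⟨rfl, rfl⟩ := Prod.mk.inj hpq
        exact ⟨.inl rfl, .inl rfl, rfl⟩
      · obtain ⟨rfl, rfl⟩ := Prod.mk.inj hpq'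
        refine ⟨.inr ⟨p, hp, rfl⟩, .inr ⟨q, hq, rfl⟩, ?_⟩
        exact (hψι p).trans ((congrArg _ hpq).trans (hψι q).symm)
  refine ⟨Option B, inferInstance, ψ, L', ⟨⟨?_, ?_, heq, ?_⟩, by rw [hpref']; exact heq⟩⟩
  · let M₁ : Language (Option B) := {s : List (Option B) | s = [none]}
    let M₂ : Language (Option B) := (List.map some '' wordLang L : Set (List (Option B)))
    have : wordLang L' = M₁ + M₂ := by
      refine (Set.image_insert_eq).trans ?_
      have : letters '' (ι '' L) = List.map some '' (letters '' L) := by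
        rw [Set.image_image, Set.image_image]
        simp only [ι, letters_map]
      rw [this]
      rfl
    rw [this]
    exact Language.IsRegular.add (isRegular_singleton _) (isRegular_map _ h.regular)
  · refine Set.eq_univ_of_forall fun s => ?_
    refine WithOne.cases_on s ⟨e, .inl rfl, hψe⟩ fun s => ?_
    obtain ⟨p, hp, rfl⟩ : s ∈ φ '' L := h.image_eq ▸ Set.mem_univ s
    exact ⟨ι p, .inr ⟨p, hp, rfl⟩, hψι p⟩
  · rintro (_ | b)
    · have he : ∀ p, ψ (p * FreeSemigroup.of none) = ψ p := fun p => by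
        rw [map_mul]
        exact (congrArg _ hψe).trans (mul_one _)
      simpa only [he] using heq
    -- Compared with the old relation there is one new pair, `(e, ι q₀)`: by `hinj`, `q₀` is the
    -- only representative of the generator `b`.
    · obtain ⟨q₀, hq₀, hφ⟩ : φ (FreeSemigroup.of b) ∈ φ '' L := h.image_eq ▸ Set.mem_univ _
      have hb : ψ (FreeSemigroup.of (some b)) = φ q₀ := by simp [ψ, hφ]
      have hmul : ∀ p, ψ (ι p * FreeSemigroup.of (some b)) = φ (p * FreeSemigroup.of b) := by
        intro p
        rw [map_mul, map_mul, WithOne.coe_mul, hψι, hb, hφ]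
      convert isRegular_padLang_map some (h.regular_mul b) e (ι q₀) using 2
      ext ⟨p, q⟩
      constructor
      · rintro ⟨rfl | ⟨p, hp, rfl⟩, rfl | ⟨q, hq, rfl⟩, hpq⟩
        · simp [hψe, hb] at hpq
        · left
          simp only [map_mul, hψe, hb, hψι, one_mul, WithOne.coe_inj] at hpq
          rw [hinj hq₀ hq hpq]
        · rw [hmul, hψe] at hpq
          exact absurd hpq WithOne.coe_ne_one
        · rw [hmul, hψι, WithOne.coe_inj] at hpq
          exact .inr ⟨(p, q), ⟨hp, hq, hpq⟩, rfl⟩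
      · rintro (hpq | ⟨⟨p, q⟩, ⟨hp, hq, hpq⟩, hpq'⟩)
        · obtain ⟨rfl, rfl⟩ := Prod.mk.inj hpq
          refine ⟨.inl rfl, .inr ⟨q₀, hq₀, rfl⟩, ?_⟩
          simp only [map_mul, hψe, hb, hψι, one_mul]
        · obtain ⟨rfl, rfl⟩ := Prod.mk.inj hpq'
          refine ⟨.inr ⟨p, hp, rfl⟩, .inr ⟨q, hq, rfl⟩, ?_⟩
          exact (hmul p).trans ((congrArg _ hpq).trans (hψι q).symm)

/-! ### Words modulo a relation as elements of the presented semigroup -/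

section Presentation

variable {A : Type u} {w v : FreeSemigroup A}

/-- The value of a possibly empty word in the presented semigroup with an identity adjoined. -/
def wordValue (w v : FreeSemigroup A) (s : List A) : WithOne (Sgp {(w, v)}) :=
  (s.map fun a => (((FreeSemigroup.of a : FreeSemigroup A) : Sgp {(w, v)}) :
    WithOne (Sgp {(w, v)}))).prod

theorem wordValue_append (s t : List A) :
    wordValue w v (s ++ t) = wordValue w v s * wordValue w v t := by
  simp [wordValue]

theorem wordValue_letters (p : FreeSemigroup A) :
    wordValue w v (letters p) = ((p : Sgp {(w, v)}) : WithOne (Sgp {(w, v)})) := by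
  induction p with
  | ih1 a => simp [wordValue, letters]
  | ih2 a p h₁ h₂ => rw [letters_mul, wordValue_append, h₁, h₂]; rfl

/-- This links the congruence generated by the relation with rewriting of lists: the congruence is
closed under products because rewriting is closed under contexts. -/
theorem wordValue_eq_iff {s t : List A} (hs : s ≠ []) (ht : t ≠ []) :
    wordValue w v s = wordValue w v t ↔ RewEqv (letters w) (letters v) s t := by
  constructor
  · obtain ⟨p, rfl⟩ := exists_letters_eq hs
    obtain ⟨q, rfl⟩ := exists_letters_eq ht
    rw [wordValue_letters, wordValue_letters, WithOne.coe_inj, Con.eq]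
    intro h
    have hrel : ConGen.Rel _ p q := h
    clear hs ht h
    induction hrel with
    | of p q h =>
      obtain ⟨rfl, rfl⟩ := Prod.mk.inj h
      exact .rel _ _ ⟨[], [], by simp, by simp⟩
    | refl => exact .refl _
    | symm _ ih => exact .symm _ _ ih
    | trans _ _ ih₁ ih₂ => exact .trans _ _ _ ih₁ ih₂
    | @mul p q p' q' _ _ ih₁ ih₂ =>
      rw [letters_mul, letters_mul]
      refine .trans _ (letters q ++ letters p') _ ?_ ?_
      · simpa using RewEqv.context ih₁ [] (letters p')
      · simpa using RewEqv.context ih₂ (letters q) []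
  · refine eqvGen_imp_eq (wordValue w v) ?_
    rintro _ _ ⟨a, b, rfl, rfl⟩
    rw [wordValue_append, wordValue_append, wordValue_append, wordValue_append, wordValue_letters,
      wordValue_letters]
    congr 3
    exact (Con.eq _).2 (ConGen.Rel.of _ _ rfl)

end Presentation

/-! ### The automatic structure -/

section Structure

variable {A : Type u}

/-- The alphabet of nonempty blocks of at most `n` letters. -/
abbrev Block (A : Type u) (n : ℕ) : Type u := {b : List A // b ≠ [] ∧ b.length ≤ n}

instance [Finite A] (n : ℕ) : Finite (Block A n) :=
  ((List.finite_length_le A n).subset fun _ hb => hb.2 : {_b : List A | _}.Finite)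

open Classical in
/-- A word as a block, with `y` as default value. -/
noncomputable def toBlock {n : ℕ} (hn : 0 < n) (y : A) (b : List A) : Block A n :=
  if h : b ≠ [] ∧ b.length ≤ n then ⟨b, h⟩ else ⟨[y], by simp, hn⟩

/-- All blocks produced are nonempty and have at most `n` letters, so the default value of `toBlock`
never occurs and the encoding is injective. -/
theorem flatMap_encode [DecidableEq A] {n : ℕ} (hn : 0 < n) (y : A) (s : List A) :
    (encode n y (toBlock hn y) s).flatMap (fun b => b.1) = s := by
  have h : (encodeFrom n y ([], false) s).map (fun b => (toBlock hn y b).1) =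
      encodeFrom n y ([], false) s := by
    refine (List.map_congr_left fun b hb => ?_).trans (List.map_id _)
    have := mem_encodeFrom (s := ([], false)) hn hn s hb
    rw [toBlock, dif_pos this, id]
  rw [encode, List.flatMap_map, List.flatMap_def, h, flatten_encodeFrom, List.nil_append]

theorem encode_ne_nil [DecidableEq A] {n : ℕ} (hn : 0 < n) (y : A) {s : List A}
    (hs : s ≠ []) : encode n y (toBlock hn y) s ≠ [] := by
  intro h
  have := flatMap_encode hn y s
  rw [h] at this
  exact hs this.symm

variable {w v : FreeSemigroup A}

theorem exists_coe_eq_wordValue {s : List A} (hs : s ≠ []) :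
    ∃ z : Sgp {(w, v)}, (z : WithOne (Sgp {(w, v)})) = wordValue w v s := by
  obtain ⟨p, rfl⟩ := exists_letters_eq hs
  exact ⟨p, (wordValue_letters p).symm⟩

/-- The homomorphism which evaluates words of blocks. -/
noncomputable def blockHom (w v : FreeSemigroup A) (n : ℕ) :
    FreeSemigroup (Block A n) →ₙ* Sgp {(w, v)} :=
  FreeSemigroup.lift fun b => (exists_coe_eq_wordValue (w := w) (v := v) b.2.1).choose

theorem coe_blockHom {n : ℕ} (p : FreeSemigroup (Block A n)) :
    (blockHom w v n p : WithOne (Sgp {(w, v)})) =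
      wordValue w v ((letters p).flatMap fun b => b.1) := by
  induction p with
  | ih1 b =>
    rw [blockHom, FreeSemigroup.lift_of,
      (exists_coe_eq_wordValue (w := w) (v := v) b.2.1).choose_spec]
    simp [letters]
  | ih2 b p h₁ h₂ =>
    rw [map_mul, WithOne.coe_mul, h₁, h₂, letters_mul, List.flatMap_append, wordValue_append]

/-- The encoded normal forms. -/
def normalLang [DecidableEq A] {n : ℕ} (hn : 0 < n) (y : A) (w : List A) :
    Set (FreeSemigroup (Block A n)) :=
  {p | ∃ s ∈ normalWords w, letters p = encode n y (toBlock hn y) s}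

theorem exists_mem_normalLang [DecidableEq A] {n : ℕ} (hn : 0 < n) (y : A) {w s : List A}
    (hs : s ∈ normalWords w) :
    ∃ p ∈ normalLang hn y w, letters p = encode n y (toBlock hn y) s := by
  obtain ⟨p, hp⟩ := exists_letters_eq (encode_ne_nil hn y hs.1)
  exact ⟨p, ⟨s, hs, hp⟩, hp⟩

/-- A nonempty prefix of an encoding encodes a prefix of the word, and avoiding `w` is inherited by
prefixes. -/
theorem pref_normalLang_subset [DecidableEq A] {n : ℕ} (hn : 0 < n) (y : A) (w : List A) :
    pref (normalLang hn y w) ⊆ normalLang hn y w := by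
  rintro p ⟨q, ⟨s, hs, hq⟩, hp⟩
  rw [hq] at hp
  obtain ⟨t, ht⟩ := hp
  obtain ⟨r, r', hr, hr', -⟩ := List.map_eq_append_iff.1 ht.symm
  have hr0 : r ≠ [] := by
    rintro rfl
    simp [letters] at hr'
  obtain ⟨s', hs', rfl⟩ := exists_encodeFrom_eq_of_prefix _ _ ⟨r', hr.symm⟩ hr0
  refine ⟨s', ⟨?_, fun h => hs.2 (h.trans hs'.isInfix)⟩, hr'.symm⟩
  rintro rfl
  simp [encodeFrom, blocks, flush] at hr0

end Structure

/-- Every language required is a case of `mulRel`: equality is multiplication by the empty word, and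
a generator multiplies by the letters of its block. -/
theorem isAutomaticStructure_normalLang {A : Type u} [Finite A] [DecidableEq A]
    {w v : FreeSemigroup A} {u : List A} {l x y : A} (hw : letters w = u ++ [l])
    (hv : letters v = [x, y]) (hu : 0 < u.length) (hxy : ¬ [x, y] <:+ u ++ [l])
    (hpow : l = x → u ≠ List.replicate u.length y) {nf : List A → List A}
    (hnf : ∀ s, ¬ u ++ [l] <:+: nf s) (hnf' : ∀ s, RewEqv (u ++ [l]) [x, y] s (nf s))
    (huniq : ∀ s t, ¬ u ++ [l] <:+: s → ¬ u ++ [l] <:+: t →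
      RewEqv (u ++ [l]) [x, y] s t → s = t) :
    IsAutomaticStructure (blockHom w v u.length) (normalLang hu y (u ++ [l])) ∧
      (normalLang hu y (u ++ [l])).InjOn (blockHom w v u.length) := by
  have henc : ∀ s t, encode u.length y (toBlock hu y) s = encode u.length y (toBlock hu y) t →
      s = t := fun s t h => by
    rw [← flatMap_encode hu y s, h, flatMap_encode]
  have hrel : ∀ r, (padRel (mulRel u.length y (toBlock hu y) (u ++ [l]) [x, y] r)).IsRegular :=
    isRegular_mulRel hu rfl hxy hpow hnf hnf' huniq fun s _ t _ => henc s t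
  have hval : ∀ {p s}, letters p = encode u.length y (toBlock hu y) s →
      (blockHom w v u.length p : WithOne (Sgp {(w, v)})) = wordValue w v s := by
    intro p s h
    rw [coe_blockHom, h, flatMap_encode]
  have hiff : ∀ {s t : List A}, s ≠ [] → t ≠ [] →
      (wordValue w v s = wordValue w v t ↔ RewEqv (u ++ [l]) [x, y] s t) := fun hs ht => by
    rw [wordValue_eq_iff hs ht, hw, hv]
  have heqset : (fun p : FreeSemigroup (Block A u.length) × FreeSemigroup (Block A u.length) =>
      (letters p.1, letters p.2)) '' {p | p.1 ∈ normalLang hu y (u ++ [l]) ∧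
        p.2 ∈ normalLang hu y (u ++ [l]) ∧
        blockHom w v u.length p.1 = blockHom w v u.length p.2} =
      mulRel u.length y (toBlock hu y) (u ++ [l]) [x, y] [] := by
    ext r
    constructor
    · rintro ⟨⟨p, q⟩, ⟨⟨s, hs, hp⟩, ⟨t, ht, hq⟩, hpq⟩, rfl⟩
      refine ⟨s, hs, t, ht, ?_, Prod.ext hp hq⟩
      rw [List.append_nil, ← hiff hs.1 ht.1, ← hval hp, ← hval hq]
      exact congrArg _ hpq
    · rintro ⟨s, hs, t, ht, hst, rfl⟩
      obtain ⟨p, hp, hp'⟩ := exists_mem_normalLang hu y hs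
      obtain ⟨q, hq, hq'⟩ := exists_mem_normalLang hu y ht
      refine ⟨(p, q), ⟨hp, hq, ?_⟩, Prod.ext hp' hq'⟩
      rw [List.append_nil, ← hiff hs.1 ht.1, ← hval hp', ← hval hq'] at hst
      exact WithOne.coe_inj.1 hst
  have hinj : (normalLang hu y (u ++ [l])).InjOn (blockHom w v u.length) := by
    rintro p ⟨s, hs, hp⟩ q ⟨t, ht, hq⟩ hpq
    apply letters_injective
    have h := congrArg (fun z : Sgp {(w, v)} => (z : WithOne (Sgp {(w, v)}))) hpq
    simp only [hval hp, hval hq] at h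
    rw [hp, hq, huniq s t hs.2 ht.2 ((hiff hs.1 ht.1).1 h)]
  refine ⟨⟨?_, ?_, ?_, fun b => ?_⟩, hinj⟩
  -- By uniqueness of normal forms the equality relation is the diagonal, from which regularity of
  -- the language itself is read off.
  · refine isRegular_of_padRel_diag ?_
    refine (congrArg (fun U => (padRel U).IsRegular) (Set.ext fun r => ?_)).mp (hrel [])
    obtain ⟨r₁, r₂⟩ := r
    constructor
    · rintro ⟨s, hs, t, ht, hst, h⟩
      obtain ⟨rfl, rfl⟩ := Prod.mk.inj h
      obtain rfl := huniq s t hs.2 ht.2 (by simpa using hst)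
      obtain ⟨p, hp, hp'⟩ := exists_mem_normalLang hu y hs
      exact ⟨⟨p, hp, hp'⟩, rfl⟩
    · rintro ⟨⟨p, ⟨s, hs, hp⟩, rfl⟩, h⟩
      exact ⟨s, hs, s, hs, by simpa using Relation.EqvGen.refl _, Prod.ext hp (h.trans hp)⟩
  · refine Set.eq_univ_of_forall fun z => ?_
    obtain ⟨p, rfl⟩ := Quotient.exists_rep z
    have hne : nf (letters p) ≠ [] := by
      have := (hnf' (letters p)).eq_nil_iff (by simp) (by simp)
      rw [ne_eq, ← this]
      simp [letters]
    obtain ⟨q, hq, hq'⟩ := exists_mem_normalLang hu y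
      (show nf (letters p) ∈ normalWords (u ++ [l]) from ⟨hne, hnf _⟩)
    refine ⟨q, hq, WithOne.coe_inj.1 ?_⟩
    rw [hval hq']
    refine Eq.trans ?_ (wordValue_letters p)
    exact ((hiff (by simp [letters]) hne).2 (hnf' _)).symm
  · rw [padLang_eq_padRel, heqset]
    exact hrel []
  · rw [padLang_eq_padRel]
    refine (congrArg (fun U => (padRel U).IsRegular) (Set.ext fun r => ?_)).mp (hrel b.1)
    have hmul : ∀ {p s}, letters p = encode u.length y (toBlock hu y) s →
        (blockHom w v u.length (p * FreeSemigroup.of b) : WithOne (Sgp {(w, v)})) =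
          wordValue w v (s ++ b.1) := by
      intro p s h
      rw [coe_blockHom, letters_mul, List.flatMap_append, h, flatMap_encode]
      simp [letters]
    have hne : ∀ s, s ++ b.1 ≠ [] := fun s => by simp [b.2.1]
    constructor
    · rintro ⟨s, hs, t, ht, hst, rfl⟩
      obtain ⟨p, hp, hp'⟩ := exists_mem_normalLang hu y hs
      obtain ⟨q, hq, hq'⟩ := exists_mem_normalLang hu y ht
      refine ⟨(p, q), ⟨hp, hq, ?_⟩, Prod.ext hp' hq'⟩
      rw [← hiff (hne s) ht.1, ← hmul hp', ← hval hq'] at hst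
      exact WithOne.coe_inj.1 hst
    · rintro ⟨⟨p, q⟩, ⟨⟨s, hs, hp⟩, ⟨t, ht, hq⟩, hpq⟩, rfl⟩
      refine ⟨s, hs, t, ht, ?_, Prod.ext hp hq⟩
      rw [← hiff (hne s) ht.1, ← hmul hp, ← hval hq]
      exact congrArg _ hpq

end AutoSgp

theorem theorem3p1p6 (F : Type v) [Field F] {A : Type u} [Finite A] [LinearOrder A]
    (w : FreeSemigroup A) (x y : A) (hk : 2 ≤ w.length)
    (hGS : AutoSgp.RelIsGroebnerShirshov F {(w, FreeSemigroup.of x * FreeSemigroup.of y)})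
    (hsuffix : ¬ [x, y] <:+ AutoSgp.letters w)
    (hpow : AutoSgp.letters w ≠ List.replicate (w.length - 1) y ++ [x]) :
    AutoSgp.IsAutomatic (AutoSgp.Sgp {(w, FreeSemigroup.of x * FreeSemigroup.of y)}) ∧
    AutoSgp.IsPrefixAutomatic
      (WithOne (AutoSgp.Sgp {(w, FreeSemigroup.of x * FreeSemigroup.of y)})) := by
  obtain ⟨hlt, hGS⟩ := hGS
  have hlt := hlt _ rfl
  have hset : {f : AutoSgp.FreeAlg F A | ∃ p ∈ ({(w, FreeSemigroup.of x * FreeSemigroup.of y)} :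
      Set (FreeSemigroup A × FreeSemigroup A)),
      f = AutoSgp.mon F (FreeMonoid.ofList (AutoSgp.letters p.1)) -
        AutoSgp.mon F (FreeMonoid.ofList (AutoSgp.letters p.2))} =
      {AutoSgp.mon F (FreeMonoid.ofList (AutoSgp.letters w)) -
        AutoSgp.mon F (FreeMonoid.ofList [x, y])} := by
    ext f
    constructor
    · rintro ⟨_, rfl, rfl⟩
      rfl
    · rintro rfl
      exact ⟨_, rfl, rfl⟩
  rw [hset] at hGS
  have hres := AutoSgp.overlapsResolve_of_groebner hlt hGS
  obtain ⟨nf, hnf, hnf', hcongr, hfix⟩ := AutoSgp.exists_normalForm hlt hres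
  obtain ⟨u, l, hul⟩ : ∃ u l, AutoSgp.letters w = u ++ [l] :=
    ⟨_, _, (List.dropLast_append_getLast (l := AutoSgp.letters w) (by simp [AutoSgp.letters])).symm⟩
  have hlen : u.length + 1 = w.length := by
    have := congrArg List.length hul
    simpa [AutoSgp.letters, FreeSemigroup.length] using this.symm
  rw [hul] at hnf hnf' hcongr hfix hsuffix hpow
  have hu : 0 < u.length := by omega
  have huniq : ∀ s t, ¬ u ++ [l] <:+: s → ¬ u ++ [l] <:+: t →
      AutoSgp.RewEqv (u ++ [l]) [x, y] s t → s = t := fun s t hs ht h => by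
    rw [← hfix s hs, ← hfix t ht, hcongr s t h]
  obtain ⟨hstruct, hinj⟩ := AutoSgp.isAutomaticStructure_normalLang
    (v := FreeSemigroup.of x * FreeSemigroup.of y) hul rfl hu hsuffix (by
      -- When `l = x`, the equation `u = yⁿ` would make the left side `y^(k-1) x`, since `n = k -
      -- 1`.
      rintro rfl h
      rw [← hlen, Nat.add_sub_cancel] at hpow
      exact hpow (congrArg (· ++ [l]) h)) hnf hnf' huniq
  exact ⟨⟨_, inferInstance, _, _, hstruct⟩, AutoSgp.isPrefixAutomatic_withOne hstruct
    (AutoSgp.pref_normalLang_subset hu y _) hinj⟩
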